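/- Let $(G_r)_{r\ge 0}$ be Vign\'eras' multiple gamma functions, i.e. the sequence of meromorphic functions on $\mathbb{C}$ which is uniquely determined by: (i) $G_0(z)=z$; (ii) $G_r(1)=1$; (iii) $G_r(z+1)=G_{r-1}(z)\,G_r(z)$ for $r\ge 1$; (iv) for real $x\ge 0$, $G_r(x+1)$ is a positive real number and $\frac{d^{r+1}}{dx^{r+1}}\log G_r(x+1)\ge 0$. (There is exactly one such sequence.) For $r\ge 1$ let the polynomials $G_{r,j}(z)$ be defined by $\binom{z-u}{r-1}=\sum_{j=0}^{r-1}G_{r,j}(z)\,u^j$, let $B_n$ be the Bernoulli numbers with $B_1=-\tfrac12$, and let $\zeta$ be the Riemann zeta function. Then for all integers $r\ge 0$ and $p\ge 1$ and all $z\in\mathbb{C}$ (as an identity of meromorphic functions in $z$), $$\prod_{q_1,\dots,q_r=0}^{p-1}G_r\!\left(\frac{z+q_1+\cdots+q_r}{p}\right)=e^{\phi_r(z)}\,p^{-\psi_r(z)}\,G_r(z),$$ where $$\phi_r(z)=-\sum_{j=0}^{r-1}\left[\sum_{q_1,\dots,q_r=0}^{p-1}G_{r,j}\!\left(\frac{z+q_1+\cdots+q_r}{p}-1\right)-G_{r,j}(z-1)\right]\zeta'(-j),$$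 $$\psi_r(z)=\binom{z}{r}+\sum_{j=0}^{r-1}\frac{B_{j+1}}{j+1}\,G_{r,j}(z-1).$$ For $r=0$ the sums over $j$ are empty and the product over the empty tuple has one factor. -/

import Mathlib

open Filter Polynomial

noncomputable section

/-- The defining conditions of the sequence `G 0, G 1, G 2, …` of multiple gamma functions of
Vignéras. Meromorphic functions on `ℂ` are represented by functions in normal form, that is, they
take their actual value wherever they are analytic and the conventional value `0` at poles. -/
structure IsVignerasGamma (G : ℕ → ℂ → ℂ) : Prop where
  /-- Every `G r` is a meromorphic function on the whole plane. -/
  meromorphic : ∀ r, MeromorphicNFOn (G r) Set.univ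
  /-- (i) `G₀(z) = z`. -/
  zero_eq : ∀ z, G 0 z = z
  /-- (ii) `G_r(1) = 1`. -/
  map_one : ∀ r, G r 1 = 1
  /-- (iii) `G_r(z + 1) = G_{r-1}(z) G_r(z)`, as an identity of meromorphic functions, that is,
  outside a closed discrete set of points. -/
  functional_eq : ∀ r, (fun z => G (r + 1) (z + 1)) =ᶠ[codiscrete ℂ] fun z => G r z * G (r + 1) z
  /-- `log G_r(x + 1)` makes sense as a real logarithm for real `x ≥ 0`. -/
  pos : ∀ r, ∀ x : ℝ, 0 ≤ x → 0 < (G r (x + 1)).re ∧ (G r (x + 1)).im = 0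
  /-- (iv) the derivative of order `r + 1` of `log G_r(x + 1)` is nonnegative for real `x ≥ 0`. -/
  deriv_log_nonneg : ∀ r, ∀ x : ℝ, 0 ≤ x →
    0 ≤ iteratedDeriv (r + 1) (fun t : ℝ => Real.log (G r (t + 1)).re) x

/-- The polynomials `G_{r,j}(z)`: for `r ≥ 1`, `G_{r,j}(z)` is the coefficient of `u ^ j` in
`binom(z - u, r - 1)` regarded as a polynomial in `u`; and `G_{0,j} = 0`. -/
def vignerasPoly : ℕ → ℕ → ℂ → ℂ
  | 0, _, _ => 0
  | r + 1, j, z => (Ring.choose (C z - X : ℂ[X]) r).coeff j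

/-- `φ_r(z) = -∑_{j<r} [∑_{q₁,…,q_r=0}^{p-1} G_{r,j}((z+q₁+⋯+q_r)/p - 1) - G_{r,j}(z - 1)] ζ'(-j)`
(it depends on `p`). -/
def vignerasPhi (p r : ℕ) (z : ℂ) : ℂ :=
  -∑ j ∈ Finset.range r,
    ((∑ q : Fin r → Fin p, vignerasPoly r j ((z + ∑ i, ((q i : ℕ) : ℂ)) / p - 1))
      - vignerasPoly r j (z - 1)) * deriv riemannZeta (-(j : ℂ))

/-- `ψ_r(z) = binom(z, r) + ∑_{j<r} B_{j+1} / (j+1) * G_{r,j}(z - 1)`, with `B₁ = -1/2`. -/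
def vignerasPsi (r : ℕ) (z : ℂ) : ℂ :=
  Ring.choose z r
    + ∑ j ∈ Finset.range r, (bernoulli (j + 1) : ℂ) / ((j : ℂ) + 1) * vignerasPoly r j (z - 1)

end

noncomputable section

/-! ### The polynomials `G_{r,j}` -/

/-! The formula is the derivative at `s = 0` of a multiplication formula for Barnes' zeta function
`ζ_r(s, x) = ∑_k multichoose(r, k) (x + k)^(-s)`, namely `∑_q ζ_r(s, (x + q₁ + ⋯ + q_r)/p) = p^s
ζ_r(s, x)`. For large `re s` both sides satisfy the same difference equation and decay at infinity
(`multisum_barnesSeries`); the identity theorem carries the formula to a neighbourhood of `s = 0`.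

Let `Z_r` be `vignerasZetaPart`, which collects the constants `ζ'(-j)` and normalises `log G_r(1) =
0`. Then `ζ_r(0, x) = (-1)^r ψ_r(x)` (`barnesZeta_zero_eq_vignerasPsi`) and `ζ_r'(0, x) = (-1)^(r+1)
(log G_r(x) - Z_r(x))` (`hasDerivAt_barnesZeta_zero`). Since `φ_r` is exactly the defect of `Z_r` in
the multiplication formula, differentiating gives `∑_q log G_r = φ_r - ψ_r log p + log G_r` for real
`x ≥ p` (`multisum_vignerasLog`).

It remains to see that these logarithms belong to Vignéras' functions. They satisfy the required
difference equation, and the derivative of order `r + 1` is `r! ζ_r(r + 1, x)`, which is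
nonnegative; the functional equation then extends `exp(log G_r)` to the plane
(`isVignerasGamma_vignerasG`). A Bohr–Mollerup argument gives uniqueness
(`IsVignerasGamma.eq_vignerasG`). Finally the identity theorem extends the formula from the real
axis to `ℂ`; at the points `-n`, where for `r ≥ 1` both sides are `0` by convention, it is checked
by hand. -/

theorem factorial_mul_ringChoose {R : Type*} [CommRing R] [BinomialRing R] (x : R) (n : ℕ) :
    (n.factorial : R) * Ring.choose x n = ∏ i ∈ Finset.range n, (x - i) := by
  rw [← nsmul_eq_mul, ← Ring.descPochhammer_eq_factorial_smul_choose]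
  induction n with
  | zero => simp
  | succ n ih =>
    rw [descPochhammer_succ_right, Polynomial.smeval_mul, ih, Finset.prod_range_succ]
    simp [Polynomial.smeval_sub, Polynomial.smeval_natCast]

theorem succ_mul_ringChoose_succ {R : Type*} [CommRing R] [BinomialRing R] [IsDomain R] [CharZero R]
    (x : R) (n : ℕ) : ((n : R) + 1) * Ring.choose x (n + 1) = Ring.choose x n * (x - n) := by
  have h : (n.factorial : R) ≠ 0 := by exact_mod_cast n.factorial_ne_zero
  apply mul_left_cancel₀ h
  have h1 := factorial_mul_ringChoose x (n + 1)
  rw [Finset.prod_range_succ, ← factorial_mul_ringChoose, Nat.factorial_succ] at h1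
  push_cast at h1
  linear_combination h1

theorem vignerasPoly_one (j : ℕ) (z : ℂ) : vignerasPoly 1 j z = if j = 0 then 1 else 0 := by
  simp [vignerasPoly, Polynomial.coeff_one]

theorem vignerasPoly_succ_succ_zero (r : ℕ) (z : ℂ) :
    ((r : ℂ) + 1) * vignerasPoly (r + 2) 0 z = (z - r) * vignerasPoly (r + 1) 0 z := by
  have h := congrArg (fun P : ℂ[X] => P.coeff 0) (succ_mul_ringChoose_succ (C z - X : ℂ[X]) r)
  simp only [vignerasPoly]
  simp only [Polynomial.mul_coeff_zero] at h
  simp at h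
  linear_combination h

theorem vignerasPoly_succ_succ_succ (r j : ℕ) (z : ℂ) :
    ((r : ℂ) + 1) * vignerasPoly (r + 2) (j + 1) z
      = (z - r) * vignerasPoly (r + 1) (j + 1) z - vignerasPoly (r + 1) j z := by
  have h := congrArg (fun P : ℂ[X] => P.coeff (j + 1)) (succ_mul_ringChoose_succ (C z - X : ℂ[X]) r)
  simp only [vignerasPoly]
  have e1 : ((r : ℂ[X]) + 1) = C ((r : ℂ) + 1) := by simp
  have e2 : Ring.choose (C z - X : ℂ[X]) r * (C z - X - (r : ℂ[X]))
      = C (z - r) * Ring.choose (C z - X : ℂ[X]) r - Ring.choose (C z - X : ℂ[X]) r * X := by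
    simp; ring
  simp only [e1, e2] at h
  rw [Polynomial.coeff_C_mul, Polynomial.coeff_sub, Polynomial.coeff_C_mul, Polynomial.coeff_mul_X] at h
  exact h

/-- The degree bound matters: it makes the polynomial part of `log G_r` disappear after `r + 1`
differentiations. -/
theorem exists_vignerasPoly_eq_eval (r j : ℕ) :
    ∃ Q : ℂ[X], Q.natDegree ≤ r ∧ ∀ z, vignerasPoly (r + 1) j z = Q.eval z := by
  induction r generalizing j with
  | zero => exact ⟨if j = 0 then 1 else 0, by split_ifs <;> simp, fun z => by
      rw [vignerasPoly_one]; split_ifs <;> simp⟩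
  | succ r ih =>
    have h : ((r : ℂ) + 1) ≠ 0 := Nat.cast_add_one_ne_zero r
    have hd : ∀ Q : ℂ[X], Q.natDegree ≤ r →
        (C ((r : ℂ) + 1)⁻¹ * ((X - C (r : ℂ)) * Q)).natDegree ≤ r + 1 := fun Q hQ => by
      refine (natDegree_C_mul_le _ _).trans (natDegree_mul_le.trans ?_)
      rw [natDegree_X_sub_C]; omega
    cases j with
    | zero =>
      obtain ⟨Q, hQd, hQ⟩ := ih 0
      refine ⟨C ((r : ℂ) + 1)⁻¹ * ((X - C (r : ℂ)) * Q), hd Q hQd, fun z => ?_⟩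
      have := vignerasPoly_succ_succ_zero r z
      rw [hQ] at this
      simp only [eval_mul, eval_C, eval_sub, eval_X, ← this]
      field_simp
    | succ j =>
      obtain ⟨Q, hQd, hQ⟩ := ih (j + 1)
      obtain ⟨S, hSd, hS⟩ := ih j
      refine ⟨C ((r : ℂ) + 1)⁻¹ * ((X - C (r : ℂ)) * Q) - C ((r : ℂ) + 1)⁻¹ * S, ?_, fun z => ?_⟩
      · refine (natDegree_sub_le _ _).trans (max_le (hd Q hQd) ?_)
        exact (natDegree_C_mul_le _ _).trans (hSd.trans (Nat.le_succ r))
      have := vignerasPoly_succ_succ_succ r j z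
      rw [hQ, hS] at this
      simp only [eval_mul, eval_C, eval_sub, eval_X]
      rw [← mul_sub, ← this]
      field_simp

theorem vignerasPoly_eq_zero_of_le {r j : ℕ} (h : r ≤ j) (z : ℂ) : vignerasPoly r j z = 0 := by
  cases r with
  | zero => rfl
  | succ r =>
    induction r generalizing j with
    | zero => rw [vignerasPoly_one, if_neg (by omega)]
    | succ r ih =>
      obtain ⟨j, rfl⟩ : ∃ i, j = i + 1 := ⟨j - 1, by omega⟩
      have := vignerasPoly_succ_succ_succ r j z
      rw [ih (by omega), ih (by omega)] at this
      have h : ((r : ℂ) + 1) ≠ 0 := Nat.cast_add_one_ne_zero r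
      simpa [h] using this

theorem sum_vignerasPoly_mul_pow (r : ℕ) (z u : ℂ) :
    ∑ j ∈ Finset.range (r + 1), vignerasPoly (r + 1) j z * u ^ j = Ring.choose (z - u) r := by
  have hd : (Ring.choose (C z - X : ℂ[X]) r).natDegree < r + 1 := by
    rw [Nat.lt_succ_iff, natDegree_le_iff_coeff_eq_zero]
    intro N hN
    exact vignerasPoly_eq_zero_of_le (r := r + 1) (by omega) z
  have := Ring.map_choose (evalRingHom u) (C z - X : ℂ[X]) r
  simp only [coe_evalRingHom, eval_sub, eval_C, eval_X] at this
  rw [← this, eval_eq_sum_range' hd]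
  rfl

/-- Pascal's rule in `z`. It gives `ψ_r` and the zeta part the same difference equation as `log
G_r`. -/
theorem vignerasPoly_add_one (r j : ℕ) (z : ℂ) :
    vignerasPoly (r + 1) j (z + 1) = vignerasPoly (r + 1) j z + vignerasPoly r j z := by
  cases r with
  | zero => simp [vignerasPoly]
  | succ r =>
    simp only [vignerasPoly]
    have : (C (z + 1) - X : ℂ[X]) = (C z - X) + 1 := by simp; ring
    rw [this, Ring.choose_succ_succ, coeff_add, add_comm]

theorem vignerasPsi_add_one (r : ℕ) (z : ℂ) :
    vignerasPsi (r + 1) (z + 1) = vignerasPsi (r + 1) z + vignerasPsi r z := by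
  have h (j : ℕ) : vignerasPoly (r + 1) j (z + 1 - 1)
      = vignerasPoly (r + 1) j (z - 1) + vignerasPoly r j (z - 1) := by
    rw [← vignerasPoly_add_one]; ring_nf
  simp only [vignerasPsi, Ring.choose_succ_succ, h, mul_add, Finset.sum_add_distrib]
  -- The sum at level `r + 1` has one more index, `j = r`, and there `G_{r,r} = 0`.
  rw [Finset.sum_range_succ (fun j => _ * vignerasPoly r j (z - 1)),
    vignerasPoly_eq_zero_of_le le_rfl]
  ring

/-- The polynomial part `-∑_j G_{r,j}(z - 1) ζ'(-j)` of `log G_r`. -/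
def vignerasZetaPart (r : ℕ) (z : ℂ) : ℂ :=
  -∑ j ∈ Finset.range r, vignerasPoly r j (z - 1) * deriv riemannZeta (-(j : ℂ))

theorem vignerasZetaPart_add_one (r : ℕ) (z : ℂ) :
    vignerasZetaPart (r + 1) (z + 1) = vignerasZetaPart (r + 1) z + vignerasZetaPart r z := by
  have h (j : ℕ) : vignerasPoly (r + 1) j (z + 1 - 1)
      = vignerasPoly (r + 1) j (z - 1) + vignerasPoly r j (z - 1) := by
    rw [← vignerasPoly_add_one]; ring_nf
  simp only [vignerasZetaPart, h, add_mul, Finset.sum_add_distrib]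
  rw [Finset.sum_range_succ (fun j => vignerasPoly r j (z - 1) * _),
    vignerasPoly_eq_zero_of_le le_rfl]
  ring

/-- This is where `φ_r` comes from: it measures how far the zeta part is from satisfying the
multiplication formula. -/
theorem vignerasPhi_eq (p r : ℕ) (z : ℂ) :
    vignerasPhi p r z = (∑ q : Fin r → Fin p, vignerasZetaPart r ((z + ∑ i, ((q i : ℕ) : ℂ)) / p))
      - vignerasZetaPart r z := by
  simp only [vignerasPhi, vignerasZetaPart, sub_mul, Finset.sum_sub_distrib, Finset.sum_mul,
    Finset.sum_neg_distrib]
  rw [Finset.sum_comm]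
  ring

theorem exists_vignerasZetaPart_eq_eval (r : ℕ) :
    ∃ Q : ℂ[X], Q.natDegree ≤ r ∧ ∀ z, vignerasZetaPart r z = Q.eval z := by
  cases r with
  | zero => exact ⟨0, by simp, by simp [vignerasZetaPart]⟩
  | succ r =>
    choose Q hQd hQ using exists_vignerasPoly_eq_eval r
    refine ⟨-∑ j ∈ Finset.range (r + 1), (Q j).comp (X - C 1) * C (deriv riemannZeta (-(j : ℂ))), ?_,
      fun z => ?_⟩
    · rw [natDegree_neg]
      refine natDegree_sum_le_of_forall_le _ _ fun j _ => ?_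
      refine (natDegree_mul_C_le _ _).trans (natDegree_comp_le.trans ?_)
      rw [natDegree_X_sub_C, mul_one]
      exact (hQd j).trans (Nat.le_succ r)
    · simp [vignerasZetaPart, eval_finsetSum, hQ, eval_comp]

theorem exists_vignerasPsi_eq_eval (r : ℕ) : ∃ Q : ℂ[X], ∀ z, vignerasPsi r z = Q.eval z := by
  have hb : ∃ S : ℂ[X], ∀ z, Ring.choose z r = S.eval z := by
    refine ⟨Ring.choose X r, fun z => ?_⟩
    have := Ring.map_choose (evalRingHom z) (X : ℂ[X]) r
    simpa using this.symm
  obtain ⟨S, hS⟩ := hb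
  cases r with
  | zero => exact ⟨S, fun z => by simp [vignerasPsi, hS]⟩
  | succ r =>
    choose Q hQd hQ using exists_vignerasPoly_eq_eval r
    refine ⟨S + ∑ j ∈ Finset.range (r + 1),
      C ((bernoulli (j + 1) : ℂ) / ((j : ℂ) + 1)) * (Q j).comp (X - C 1), fun z => ?_⟩
    simp only [vignerasPsi, eval_finsetSum, hQ, eval_comp, hS, eval_add, eval_mul, eval_C, eval_sub,
      eval_X]

/-- The coefficients of `multichoose (r + 1) k` as a polynomial in `k + 1`. -/
def multichooseCoeff (r j : ℕ) : ℂ := (-1) ^ r * vignerasPoly (r + 1) j 0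

/-- By reflection `multichoose(r + 1, k) = binom(k + r, r) = (-1)^r binom(-(k + 1), r)`, which is
the generating polynomial at `z = 0`, `u = k + 1`. -/
theorem sum_multichooseCoeff_mul_pow (r k : ℕ) :
    ∑ j ∈ Finset.range (r + 1), multichooseCoeff r j * ((k : ℂ) + 1) ^ j
      = (Nat.multichoose (r + 1) k : ℂ) := by
  simp only [multichooseCoeff, mul_assoc, ← Finset.mul_sum, sum_vignerasPoly_mul_pow]
  rw [zero_sub, Ring.choose_neg, show ((k : ℂ) + 1 + r - 1) = ((k + r : ℕ) : ℂ) by push_cast; ring,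
    Ring.choose_natCast, Nat.multichoose_eq, show r + 1 + k - 1 = k + r by omega,
    Nat.choose_symm_add]
  simp only [Int.negOnePow_def, Units.smul_def]
  simp
  rw [← mul_assoc, ← mul_pow]; simp

theorem vignerasPoly_succ_zero_zero (r : ℕ) :
    vignerasPoly (r + 1) 0 0 = if r = 0 then 1 else 0 := by
  have := sum_vignerasPoly_mul_pow r 0 0
  rw [Finset.sum_range_succ'] at this
  simp only [sub_zero, Ring.choose_zero_ite] at this
  simpa using this

/-- Lets a polynomial be identified from its difference equation on positive integers and its value
at `1`. -/
theorem Polynomial.eval_eq_of_periodic_nat {Q : ℂ[X]}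
    (h : ∀ n : ℕ, Q.eval ((n : ℂ) + 1 + 1) = Q.eval ((n : ℂ) + 1)) (z : ℂ) :
    Q.eval z = Q.eval 1 := by
  have h1 : ∀ n : ℕ, Q.eval ((n : ℂ) + 1) = Q.eval 1 := fun n => by
    induction n with
    | zero => simp
    | succ n ih => rw [← ih]; push_cast; exact h n
  have : Q = C (Q.eval 1) := by
    refine Polynomial.eq_of_infinite_eval_eq _ _ (Set.Infinite.mono ?_
      (Set.infinite_range_of_injective (f := fun n : ℕ => (n : ℂ) + 1) fun a b hab => by
        simpa using hab))
    rintro _ ⟨n, rfl⟩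
    simp [h1]
  rw [this]; simp

theorem vignerasPsi_one (r : ℕ) :
    vignerasPsi (r + 1) 1
      = (-1) ^ (r + 1) * ∑ j ∈ Finset.range (r + 1), multichooseCoeff r j * riemannZeta (-(j : ℂ)) := by
  -- With `B₁ = -1/2` the formula `ζ(-j) = -B_{j+1}/(j+1)` is off by `1` at `j = 0`; this correction
  -- produces the term `binom(1, r + 1)` of `ψ_{r+1}(1)`.
  have hz : ∀ j : ℕ, riemannZeta (-(j : ℂ)) = -(bernoulli (j + 1) : ℂ) / (j + 1) -
      if j = 0 then 1 else 0 := by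
    intro j
    rcases Nat.eq_zero_or_pos j with rfl | hj
    · simp [riemannZeta_zero, _root_.bernoulli_one]; norm_num
    · rw [riemannZeta_neg_nat_eq_bernoulli, if_neg hj.ne', sub_zero]
      rcases Nat.even_or_odd j with he | ho
      · rw [bernoulli_eq_zero_of_odd he.add_one (by omega)]; simp
      · rw [ho.neg_one_pow]; ring
  have hc : Ring.choose (1 : ℂ) (r + 1) = if r = 0 then 1 else 0 := by
    have := Ring.choose_natCast (R := ℂ) 1 (r + 1)
    rw [Nat.cast_one] at this
    rw [this]
    split_ifs with h
    · simp [h]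
    · rw [Nat.choose_eq_zero_of_lt (by omega), Nat.cast_zero]
  have hs : ((-1 : ℂ)) ^ r * (-1) ^ r = 1 := by rw [← mul_pow]; simp
  simp only [vignerasPsi, hc, sub_self, Finset.mul_sum, hz, multichooseCoeff]
  have : ∀ j : ℕ, (-1 : ℂ) ^ (r + 1) * ((-1) ^ r * vignerasPoly (r + 1) j 0 *
      (-(bernoulli (j + 1) : ℂ) / (j + 1) - if j = 0 then 1 else 0))
      = (bernoulli (j + 1) : ℂ) / (j + 1) * vignerasPoly (r + 1) j 0
        + if j = 0 then vignerasPoly (r + 1) 0 0 else 0 := by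
    intro j
    rw [pow_succ]
    split_ifs with h
    · subst h
      linear_combination (vignerasPoly (r + 1) 0 0 *
        ((bernoulli (0 + 1) : ℂ) / ((0 : ℕ) + 1) + 1)) * hs
    · linear_combination (vignerasPoly (r + 1) j 0 * ((bernoulli (j + 1) : ℂ) / (j + 1))) * hs
  simp only [this, Finset.sum_add_distrib, vignerasPoly_succ_zero_zero]
  rw [add_comm]
  simp

/-! ### Taylor remainders of complex powers -/

/-- The binomial coefficient `binom(-s, n)`. -/
def negBinom (n : ℕ) (s : ℂ) : ℂ := ∏ i ∈ Finset.range n, (-s - i) / (i + 1)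

theorem negBinom_zero (s : ℂ) : negBinom 0 s = 1 := by simp [negBinom]

theorem negBinom_succ (n : ℕ) (s : ℂ) :
    negBinom (n + 1) s = negBinom n s * ((-s - n) / (n + 1)) := by
  rw [negBinom, Finset.prod_range_succ, negBinom]

theorem succ_mul_negBinom_succ (n : ℕ) (s : ℂ) :
    ((n : ℂ) + 1) * negBinom (n + 1) s = -s * negBinom n (s + 1) := by
  induction n with
  | zero => simp [negBinom]
  | succ n ih =>
    rw [negBinom_succ (n + 1), negBinom_succ n (s + 1)]
    have h1 : ((n : ℂ) + 1) ≠ 0 := Nat.cast_add_one_ne_zero n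
    have h2 : (((n + 1 : ℕ) : ℂ) + 1) ≠ 0 := Nat.cast_add_one_ne_zero (n + 1)
    push_cast at h2 ⊢
    field_simp
    linear_combination (-s - (n + 1)) * ih

theorem differentiable_negBinom (n : ℕ) : Differentiable ℂ (negBinom n) := by
  unfold negBinom
  fun_prop

theorem negBinom_succ_zero (n : ℕ) : negBinom (n + 1) 0 = 0 := by
  simp [negBinom, Finset.prod_range_succ']

/-- The simple zero at `s = 0` cancels the pole of zeta, and the slope is a Taylor coefficient of
`-log(1 + u)`. -/
theorem hasDerivAt_negBinom_succ_zero (n : ℕ) :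
    HasDerivAt (negBinom (n + 1)) ((-1) ^ (n + 1) / ((n : ℂ) + 1)) 0 := by
  induction n with
  | zero =>
    have : negBinom (0 + 1) = fun s => -s := by ext s; simp [negBinom]
    rw [this]
    simpa using hasDerivAt_neg (0 : ℂ)
  | succ n ih =>
    have h0 : negBinom (n + 1 + 1)
        = fun s => negBinom (n + 1) s * ((-s - (n + 1 : ℕ)) / ((n + 1 : ℕ) + 1)) := by
      ext s; rw [negBinom_succ]
    rw [h0]
    have h2 : (((n + 1 : ℕ) : ℂ) + 1) ≠ 0 := Nat.cast_add_one_ne_zero (n + 1)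
    have h1 : ((n : ℂ) + 1) ≠ 0 := Nat.cast_add_one_ne_zero n
    have h3 : HasDerivAt (fun s : ℂ => (-s - (n + 1 : ℕ)) / (((n + 1 : ℕ) : ℂ) + 1))
        (-1 / (((n + 1 : ℕ) : ℂ) + 1)) 0 :=
      (((hasDerivAt_neg (0 : ℂ)).sub_const _).div_const _)
    refine (ih.mul h3).congr_deriv ?_
    rw [negBinom_succ_zero]
    push_cast at h2 ⊢
    field_simp
    ring

/-- The remainder of order `M` in the binomial expansion of `(1 + u) ^ (-s)`. -/
def powRemainder (M : ℕ) (s : ℂ) (u : ℝ) : ℂ :=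
  (1 + u : ℂ) ^ (-s) - ∑ n ∈ Finset.range M, negBinom n s * (u : ℂ) ^ n

theorem powRemainder_succ_at_zero (M : ℕ) (s : ℂ) : powRemainder (M + 1) s 0 = 0 := by
  simp [powRemainder, Finset.sum_range_succ', negBinom_zero]

theorem powRemainder_succ_zero (M : ℕ) (u : ℝ) : powRemainder (M + 1) 0 u = 0 := by
  simp [powRemainder, Finset.sum_range_succ', negBinom_zero, negBinom_succ_zero]

/-- Differentiation in `u` lowers the order and replaces `s` by `s + 1`, which sets up an induction
on the order. -/
theorem hasDerivAt_powRemainder (M : ℕ) (s : ℂ) {u : ℝ} (hu : 0 ≤ u) :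
    HasDerivAt (powRemainder (M + 1) s) (-s * powRemainder M (s + 1) u) u := by
  have hslit : (1 + (u : ℂ)) ∈ Complex.slitPlane := by
    left; simp; linarith
  have h1 : HasDerivAt (fun v : ℝ => (1 + (v : ℂ)) ^ (-s)) (-s * (1 + (u : ℂ)) ^ (-s - 1)) u := by
    have h0 : HasDerivAt (fun v : ℝ => 1 + (v : ℂ)) 1 u :=
      (Complex.ofRealCLM.hasDerivAt (x := u)).const_add 1
    exact ((Complex.hasStrictDerivAt_cpow_const (c := -s) hslit).hasDerivAt.comp u h0).congr_deriv
      (mul_one _)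
  have h2 : HasDerivAt (fun v : ℝ => ∑ n ∈ Finset.range (M + 1), negBinom n s * (v : ℂ) ^ n)
      (∑ n ∈ Finset.range (M + 1), negBinom n s * (n * (u : ℂ) ^ (n - 1))) u := by
    refine HasDerivAt.fun_sum fun n _ => HasDerivAt.const_mul _ ?_
    exact (((Complex.ofRealCLM.hasDerivAt (x := u))).pow n).congr_deriv (by simp)
  refine (h1.sub h2).congr_deriv ?_
  rw [Finset.sum_range_succ', powRemainder, mul_sub, Finset.mul_sum, neg_add']
  simp only [Nat.cast_zero, zero_mul, mul_zero, add_zero]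
  congr 1
  refine Finset.sum_congr rfl fun n _ => ?_
  rw [← mul_assoc (-s), ← succ_mul_negBinom_succ]
  simp
  ring

theorem exists_norm_powRemainder_le (U : ℝ) (M : ℕ) (A : ℝ) : ∃ C : ℝ, 0 ≤ C ∧
    ∀ s : ℂ, ‖s‖ ≤ A → ∀ u ∈ Set.Icc 0 U, ‖powRemainder M s u‖ ≤ C * u ^ M := by
  induction M generalizing A with
  | zero =>
    refine ⟨|1 + U| ^ A, by positivity, fun s hs u hu => ?_⟩
    have h1 : (0 : ℝ) < 1 + u := by linarith [hu.1]
    simp only [powRemainder, Finset.range_zero, Finset.sum_empty, sub_zero, pow_zero, mul_one]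
    rw [show (1 + u : ℂ) = ((1 + u : ℝ) : ℂ) by push_cast; rfl,
      Complex.norm_cpow_eq_rpow_re_of_pos h1, abs_of_nonneg (by linarith [hu.1, hu.2])]
    calc (1 + u) ^ (-s).re ≤ (1 + u) ^ A :=
          Real.rpow_le_rpow_of_exponent_le (by linarith [hu.1])
            ((Complex.re_le_norm _).trans (by simpa using hs))
      _ ≤ (1 + U) ^ A :=
          Real.rpow_le_rpow h1.le (by linarith [hu.2]) ((norm_nonneg s).trans hs)
  | succ M ih =>
    -- The radius grows by one because the derivative of the remainder involves `s + 1`.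
    obtain ⟨C, hC0, hC⟩ := ih (A + 1)
    refine ⟨|A| * C, by positivity, fun s hs u hu => ?_⟩
    have hA : 0 ≤ A := (norm_nonneg s).trans hs
    have key := Convex.norm_image_sub_le_of_norm_hasDerivWithin_le (𝕜 := ℝ)
      (f := powRemainder (M + 1) s) (f' := fun v => -s * powRemainder M (s + 1) v)
      (C := |A| * C * u ^ M) (s := Set.Icc 0 u) (x := 0) (y := u)
      (fun v hv => (hasDerivAt_powRemainder M s hv.1).hasDerivWithinAt) ?_ (convex_Icc 0 u)
      ⟨le_rfl, hu.1⟩ ⟨hu.1, le_rfl⟩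
    · rw [powRemainder_succ_at_zero, sub_zero, sub_zero, Real.norm_of_nonneg hu.1] at key
      rw [pow_succ, ← mul_assoc]
      exact key
    · intro v hv
      rw [norm_mul, norm_neg, mul_assoc]
      have h2 : ‖powRemainder M (s + 1) v‖ ≤ C * v ^ M :=
        hC (s + 1) ((norm_add_le _ _).trans (by simpa using hs)) v ⟨hv.1, hv.2.trans hu.2⟩
      have h3 : C * v ^ M ≤ C * u ^ M :=
        mul_le_mul_of_nonneg_left (pow_le_pow_left₀ hv.1 hv.2 M) hC0
      exact mul_le_mul (hs.trans (le_abs_self A)) (h2.trans h3) (norm_nonneg _) (abs_nonneg A)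

theorem differentiable_powRemainder (M : ℕ) {u : ℝ} (hu : 0 ≤ u) :
    Differentiable ℂ fun s => powRemainder M s u := by
  have h : (1 + u : ℂ) ≠ 0 := by
    have : (0 : ℝ) < 1 + u := by linarith
    exact_mod_cast this.ne'
  unfold powRemainder
  refine Differentiable.sub ?_ ?_
  · exact (differentiable_id.neg).const_cpow (Or.inl h)
  · exact Differentiable.fun_sum fun n _ => (differentiable_negBinom n).mul_const _

theorem hasDerivAt_powRemainder_zero (M : ℕ) {u : ℝ} (hu : 0 ≤ u) :
    HasDerivAt (fun s => powRemainder M s u)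
      (-(Complex.log (1 + u) - Complex.logTaylor M u)) 0 := by
  have h : (1 + u : ℂ) ≠ 0 := by
    have : (0 : ℝ) < 1 + u := by linarith
    exact_mod_cast this.ne'
  have h1 : HasDerivAt (fun s : ℂ => (1 + u : ℂ) ^ (-s)) (-Complex.log (1 + u)) 0 := by
    have := (hasDerivAt_id (0 : ℂ)).neg.const_cpow (c := (1 + u : ℂ)) (Or.inl h)
    simpa using this
  have h2 : HasDerivAt (fun s : ℂ => ∑ n ∈ Finset.range M, negBinom n s * (u : ℂ) ^ n)
      -- The `n = 0` coefficient is `1 / 0 = 0`, as it should be: `negBinom 0` is constant.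
      (∑ n ∈ Finset.range M, (-1) ^ n / (n : ℂ) * (u : ℂ) ^ n) 0 := by
    refine HasDerivAt.fun_sum fun n _ => HasDerivAt.mul_const ?_ _
    cases n with
    | zero =>
      have : negBinom 0 = fun _ => (1 : ℂ) := by ext s; simp [negBinom]
      rw [this]; simpa using hasDerivAt_const (0 : ℂ) (1 : ℂ)
    | succ n => simpa using hasDerivAt_negBinom_succ_zero n
  refine (h1.sub h2).congr_deriv ?_
  simp only [Complex.logTaylor]
  rw [neg_sub', sub_right_inj, ← Finset.sum_neg_distrib]
  refine Finset.sum_congr rfl fun n _ => ?_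
  rw [pow_succ]; ring

/-! ### Barnes series -/

theorem multichoose_succ_le (r k : ℕ) : Nat.multichoose (r + 1) k ≤ (k + 1) ^ r := by
  induction r generalizing k with
  | zero => simp
  | succ r ih =>
    induction k with
    | zero => simp
    | succ k ihk =>
      rw [Nat.multichoose_succ_succ]
      calc _ ≤ (k + 1 + 1) ^ r + (k + 1) ^ (r + 1) := add_le_add (ih _) ihk
        _ ≤ (k + 1 + 1) ^ r + (k + 1) * (k + 1 + 1) ^ r := by
          rw [pow_succ, mul_comm]; gcongr; omega
        _ = _ := by ring

/-- The series `∑_k multichoose(r, k) (x + k)^(-s)` of Barnes' zeta function, convergent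
for `re s > r`. -/
def barnesSeries (r : ℕ) (s x : ℂ) : ℂ := ∑' k : ℕ, (Nat.multichoose r k : ℂ) * (x + k) ^ (-s)

theorem summable_natCast_succ_rpow {a : ℝ} (ha : a < -1) :
    Summable fun k : ℕ => ((k : ℝ) + 1) ^ a := by
  have := (summable_nat_add_iff 1).2 (Real.summable_nat_rpow.2 ha)
  simpa using this

theorem norm_ofReal_add_natCast_cpow {x : ℝ} (hx : 0 < x) (k : ℕ) (s : ℂ) :
    ‖(x + k : ℂ) ^ (-s)‖ = (x + k) ^ (-s.re) := by
  rw [show (x + k : ℂ) = ((x + k : ℝ) : ℂ) by push_cast; rfl,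
    Complex.norm_cpow_eq_rpow_re_of_pos (by positivity)]
  simp

theorem multichoose_mul_rpow_le {r : ℕ} {σ : ℝ} (hσ : (r : ℝ) < σ) {x : ℝ} (hx : 1 ≤ x) (k : ℕ) :
    (Nat.multichoose r k : ℝ) * (x + k) ^ (-σ) ≤ ((k : ℝ) + 1) ^ ((r : ℝ) - 1 - σ) := by
  have hσ0 : 0 < σ := (Nat.cast_nonneg r).trans_lt hσ
  have h1 : (x + k) ^ (-σ) ≤ ((k : ℝ) + 1) ^ (-σ) :=
    Real.rpow_le_rpow_of_nonpos (by positivity) (by linarith) (by linarith)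
  have h2 : (Nat.multichoose r k : ℝ) ≤ ((k : ℝ) + 1) ^ ((r : ℝ) - 1) := by
    cases r with
    | zero =>
      cases k with
      | zero => simp
      | succ k => rw [Nat.multichoose_zero_succ]; simp; positivity
    | succ r =>
      push_cast
      rw [add_sub_cancel_right, Real.rpow_natCast]
      exact_mod_cast multichoose_succ_le r k
  calc _ ≤ ((k : ℝ) + 1) ^ ((r : ℝ) - 1) * ((k : ℝ) + 1) ^ (-σ) := by gcongr
    _ = _ := by rw [← Real.rpow_add (by positivity)]; ring_nf

theorem norm_barnesSeries_term_le {r : ℕ} {s : ℂ} (hs : (r : ℝ) < s.re) {x : ℝ} (hx : 1 ≤ x)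
    (k : ℕ) : ‖(Nat.multichoose r k : ℂ) * (x + k : ℂ) ^ (-s)‖
      ≤ ((k : ℝ) + 1) ^ ((r : ℝ) - 1 - s.re) := by
  rw [norm_mul, norm_ofReal_add_natCast_cpow (by linarith), Complex.norm_natCast]
  exact multichoose_mul_rpow_le hs hx k

theorem summable_barnesSeries {r : ℕ} {s : ℂ} (hs : (r : ℝ) < s.re) {x : ℝ} (hx : 1 ≤ x) :
    Summable fun k : ℕ => (Nat.multichoose r k : ℂ) * (x + k : ℂ) ^ (-s) :=
  Summable.of_norm_bounded (summable_natCast_succ_rpow (by linarith))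
    (norm_barnesSeries_term_le hs hx)

theorem barnesSeries_zero (s x : ℂ) : barnesSeries 0 s x = x ^ (-s) := by
  rw [barnesSeries, tsum_eq_single 0]
  · simp
  · intro k hk
    obtain ⟨k, rfl⟩ := Nat.exists_eq_succ_of_ne_zero hk
    simp [Nat.multichoose_zero_succ]

/-- Pascal's rule `multichoose(r+1, k+1) = multichoose(r, k+1) + multichoose(r+1, k)`: shifting `x`
by one removes the last term. -/
theorem barnesSeries_sub_add_one {r : ℕ} {s : ℂ} (hs : (r : ℝ) + 1 < s.re) {x : ℝ} (hx : 1 ≤ x) :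
    barnesSeries (r + 1) s x - barnesSeries (r + 1) s (x + 1) = barnesSeries r s x := by
  have hs1 : ((r + 1 : ℕ) : ℝ) < s.re := by push_cast; exact hs
  have h1 := summable_barnesSeries hs1 hx
  have h2 := summable_barnesSeries hs1 (x := x + 1) (by linarith)
  have h0 := summable_barnesSeries (r := r) (s := s) (by linarith) hx
  simp only [barnesSeries]
  rw [h1.tsum_eq_zero_add, h0.tsum_eq_zero_add]
  push_cast at h2
  have h1' := (summable_nat_add_iff 1).2 h1
  rw [add_sub_assoc, ← h1'.tsum_sub h2]
  simp only [Nat.multichoose_zero_right, add_right_inj]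
  refine tsum_congr fun k => ?_
  rw [Nat.multichoose_succ_succ]
  push_cast
  rw [show (x : ℂ) + 1 + k = x + (k + 1) by ring]
  ring

/-- A periodic difference of such series must vanish; the uniqueness argument uses the same decay.
-/
theorem tendsto_barnesSeries_atTop {r : ℕ} {s : ℂ} (hs : (r : ℝ) < s.re) {x : ℝ} (hx : 1 ≤ x) :
    Tendsto (fun N : ℕ => barnesSeries r s ((x + N : ℝ) : ℂ)) atTop (nhds 0) := by
  have hs0 : 0 < s.re := (Nat.cast_nonneg r).trans_lt hs
  have := tendsto_tsum_of_dominated_convergence (𝓕 := (atTop : Filter ℕ))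
    (f := fun N k => (Nat.multichoose r k : ℂ) * (((x + N : ℝ) : ℂ) + k) ^ (-s)) (g := fun _ => 0)
    (summable_natCast_succ_rpow (a := (r : ℝ) - 1 - s.re) (by linarith)) ?_
    (Eventually.of_forall fun N k =>
      norm_barnesSeries_term_le hs (x := x + N) (by linarith [Nat.cast_nonneg (α := ℝ) N]) k)
  · simpa [barnesSeries] using this
  · intro k
    rw [tendsto_zero_iff_norm_tendsto_zero]
    have hpos : ∀ N : ℕ, 0 < x + N := fun N => by positivity
    simp only [norm_mul, norm_ofReal_add_natCast_cpow (hpos _)]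
    rw [show (0 : ℝ) = ‖(Nat.multichoose r k : ℂ)‖ * 0 by simp]
    refine Tendsto.const_mul _ ((tendsto_rpow_neg_atTop hs0).comp ?_)
    refine tendsto_atTop_add_const_right _ _ ?_
    exact tendsto_atTop_add_const_left _ _ tendsto_natCast_atTop_atTop

/-! ### Continuation of Barnes' zeta function -/

theorem meromorphicAt_riemannZeta (s : ℂ) : MeromorphicAt riemannZeta s := by
  by_cases hs : s = 1
  · subst hs
    set ξ : ℂ → ℂ := Function.update (fun s => (s - 1) * riemannZeta s) 1 1 with hξ
    have h1 : AnalyticAt ℂ ξ 1 := by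
      refine Complex.analyticAt_of_differentiable_on_punctured_nhds_of_continuousAt ?_ ?_
      · filter_upwards [self_mem_nhdsWithin] with z hz
        have : ξ =ᶠ[nhds z] fun s => (s - 1) * riemannZeta s := by
          filter_upwards [isOpen_ne.mem_nhds hz] with y hy
          simp [hξ, Function.update_of_ne hy]
        refine DifferentiableAt.congr_of_eventuallyEq ?_ this
        exact (by fun_prop : DifferentiableAt ℂ (fun s : ℂ => s - 1) z).mul
          (differentiableAt_riemannZeta hz)
      · rw [hξ, continuousAt_update_same]
        exact riemannZeta_residue_one
    have h2 : MeromorphicAt (fun s => ξ s / (s - 1)) 1 :=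
      h1.meromorphicAt.div (by fun_prop : AnalyticAt ℂ (fun s : ℂ => s - 1) 1).meromorphicAt
    refine h2.congr ?_
    filter_upwards [self_mem_nhdsWithin] with z hz
    have : z - 1 ≠ 0 := sub_ne_zero.2 hz
    simp only [hξ, Function.update_of_ne hz]
    field_simp
  · exact (analyticOn_riemannZeta s hs).meromorphicAt

/-- The continuation of `∑_k multichoose(r + 1, k) (k + 1) ^ (-s)`. -/
def zetaSum (r : ℕ) (s : ℂ) : ℂ :=
  ∑ j ∈ Finset.range (r + 1), multichooseCoeff r j * riemannZeta (s - j)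

theorem hasSum_zetaSum {r : ℕ} {s : ℂ} (hs : (r : ℝ) + 1 < s.re) :
    HasSum (fun k : ℕ => (Nat.multichoose (r + 1) k : ℂ) * ((k : ℂ) + 1) ^ (-s)) (zetaSum r s) := by
  have h1 : ∀ j ∈ Finset.range (r + 1), HasSum (fun k : ℕ =>
      multichooseCoeff r j * (1 / ((k : ℂ) + 1) ^ (s - j))) (multichooseCoeff r j * riemannZeta (s - j)) := by
    intro j hj
    have hj' : (j : ℝ) ≤ r := by exact_mod_cast Nat.lt_succ_iff.1 (Finset.mem_range.1 hj)
    have hre : 1 < (s - j).re := by simp; linarith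
    refine HasSum.mul_left _ ?_
    rw [zeta_eq_tsum_one_div_nat_add_one_cpow hre]
    have := (summable_nat_add_iff 1).2 (Complex.summable_one_div_nat_cpow.2 hre)
    push_cast at this
    exact this.hasSum
  convert hasSum_sum h1 using 2 with k
  have hk : ((k : ℂ) + 1) ≠ 0 := Nat.cast_add_one_ne_zero k
  rw [← sum_multichooseCoeff_mul_pow, Finset.sum_mul]
  refine Finset.sum_congr rfl fun j _ => ?_
  rw [one_div, ← Complex.cpow_neg, neg_sub, sub_eq_add_neg, Complex.cpow_add _ _ hk,
    Complex.cpow_natCast]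
  · ring
  · rfl

theorem meromorphicAt_zetaSum (r : ℕ) (s : ℂ) : MeromorphicAt (zetaSum r) s := by
  unfold zetaSum
  refine MeromorphicAt.fun_sum fun j _ => MeromorphicAt.mul (MeromorphicAt.const _ _) ?_
  exact (meromorphicAt_riemannZeta (s - j)).comp_analyticAt (g := fun z => z - (j : ℂ)) (by fun_prop)

theorem meromorphicAt_negBinom_mul_zetaSum (r n : ℕ) (s : ℂ) :
    MeromorphicAt (fun s => negBinom n s * zetaSum r (s + n)) s := by
  refine MeromorphicAt.mul ((differentiable_negBinom n).analyticAt s).meromorphicAt ?_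
  exact (meromorphicAt_zetaSum r (s + n)).comp_analyticAt (g := fun z => z + (n : ℂ)) (by fun_prop)

/-- A pole at `s = 0` can only come from `ζ(s + n - j)` with `n = j + 1`; then `n ≥ 1` and `negBinom
n` has a simple zero there. -/
theorem tendsto_negBinom_mul_zetaSum (r n : ℕ) :
    ∃ c, Tendsto (fun s => negBinom n s * zetaSum r (s + n)) (nhdsWithin 0 {0}ᶜ) (nhds c) := by
  have hj : ∀ j : ℕ, ∃ c, Tendsto (fun s => negBinom n s * (multichooseCoeff r j *
      riemannZeta (s + n - j))) (nhdsWithin 0 {0}ᶜ) (nhds c) := by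
    intro j
    by_cases hn : n = j + 1
    · subst hn
      -- The product is read as `(negBinom n s / s) · (s ζ(s + 1))`, both factors having limits.
      have h1 := (hasDerivAt_negBinom_succ_zero j).tendsto_slope
      have h2 : Tendsto (fun s : ℂ => s * riemannZeta (s + 1)) (nhdsWithin 0 {0}ᶜ) (nhds 1) := by
        have h3 : Tendsto (fun s : ℂ => s + 1) (nhdsWithin 0 {0}ᶜ) (nhdsWithin 1 {1}ᶜ) := by
          refine tendsto_nhdsWithin_iff.2 ⟨?_, ?_⟩
          · have : Tendsto (fun s : ℂ => s + 1) (nhds 0) (nhds (0 + 1)) := by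
              exact (continuous_id.add continuous_const).tendsto 0
            rw [zero_add] at this
            exact this.mono_left nhdsWithin_le_nhds
          · filter_upwards [self_mem_nhdsWithin] with s hs
            simpa using hs
        have := riemannZeta_residue_one.comp h3
        refine this.congr fun s => ?_
        simp
      refine ⟨_, ((h1.mul h2).const_mul (multichooseCoeff r j)).congr' ?_⟩
      filter_upwards [self_mem_nhdsWithin] with s hs
      have hs' : s ≠ 0 := hs
      rw [slope_def_field, negBinom_succ_zero, show s + ((j + 1 : ℕ) : ℂ) - j = s + 1 by push_cast; ring]
      field_simp
      simp
    · refine ⟨_, (ContinuousAt.tendsto ?_).mono_left nhdsWithin_le_nhds⟩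
      have h1 : (0 : ℂ) + n - j ≠ 1 := by
        intro h
        apply hn
        have : (n : ℂ) = ((j + 1 : ℕ) : ℂ) := by push_cast; linear_combination h
        exact_mod_cast this
      have h2 : ContinuousAt (fun s : ℂ => riemannZeta (s + n - j)) 0 :=
        ContinuousAt.comp (f := fun s : ℂ => s + n - j) (x := (0 : ℂ))
          (differentiableAt_riemannZeta h1).continuousAt (by fun_prop)
      exact (differentiable_negBinom n).continuous.continuousAt.mul (continuousAt_const.mul h2)
  choose c hc using hj
  refine ⟨∑ j ∈ Finset.range (r + 1), c j, ?_⟩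
  simp only [zetaSum, Finset.mul_sum]
  exact tendsto_finsetSum _ fun j _ => hc j

/-- The coefficient of `(x - 1) ^ n` in the Taylor part of the continued Barnes zeta function. -/
def taylorCoeff (r n : ℕ) : ℂ → ℂ :=
  toMeromorphicNFAt (fun s => negBinom n s * zetaSum r (s + n)) 0

theorem analyticAt_taylorCoeff (r n : ℕ) : AnalyticAt ℂ (taylorCoeff r n) 0 :=
  (meromorphicAt_negBinom_mul_zetaSum r n 0).meromorphicOrderAt_nonneg_iff_analyticAt_toMeromorphicNFAt.1
    ((tendsto_nhds_iff_meromorphicOrderAt_nonneg (meromorphicAt_negBinom_mul_zetaSum r n 0)).1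
      (tendsto_negBinom_mul_zetaSum r n))

theorem taylorCoeff_of_ne {r n : ℕ} {s : ℂ} (hs : s ≠ 0) :
    taylorCoeff r n s = negBinom n s * zetaSum r (s + n) :=
  ((meromorphicAt_negBinom_mul_zetaSum r n 0).eqOn_compl_singleton_toMeromorphicNFAt hs).symm

theorem meromorphicAt_taylorCoeff (r n : ℕ) (s : ℂ) : MeromorphicAt (taylorCoeff r n) s := by
  by_cases hs : s = 0
  · rw [hs]; exact (analyticAt_taylorCoeff r n).meromorphicAt
  · refine (meromorphicAt_negBinom_mul_zetaSum r n s).congr ?_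
    filter_upwards [nhdsWithin_le_nhds (isOpen_ne.mem_nhds hs)] with z hz
    rw [taylorCoeff_of_ne hz]

theorem analyticAt_zetaSum_zero (r : ℕ) : AnalyticAt ℂ (zetaSum r) 0 := by
  unfold zetaSum
  refine Finset.analyticAt_fun_sum _ fun j _ => analyticAt_const.mul ?_
  have h1 : (0 : ℂ) - j ≠ 1 := by
    intro h
    have : ((j + 1 : ℕ) : ℂ) = 0 := by push_cast; linear_combination -h
    exact absurd (Nat.cast_eq_zero.1 this) (by omega)
  exact AnalyticAt.fun_comp (analyticOn_riemannZeta _ h1) (by fun_prop)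

theorem taylorCoeff_zero (r : ℕ) : taylorCoeff r 0 = zetaSum r := by
  have : (fun s => negBinom 0 s * zetaSum r (s + (0 : ℕ))) = zetaSum r := by
    ext s; simp [negBinom_zero]
  rw [taylorCoeff, this, toMeromorphicNFAt_eq_self]
  exact (analyticAt_zetaSum_zero r).meromorphicNFAt

theorem deriv_zetaSum_zero (r : ℕ) : deriv (zetaSum r) 0
    = ∑ j ∈ Finset.range (r + 1), multichooseCoeff r j * deriv riemannZeta (-(j : ℂ)) := by
  refine HasDerivAt.deriv ?_
  unfold zetaSum
  refine HasDerivAt.fun_sum fun j _ => HasDerivAt.const_mul _ ?_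
  have h1 : (0 : ℂ) - j ≠ 1 := by
    intro h
    have : ((j + 1 : ℕ) : ℂ) = 0 := by push_cast; linear_combination -h
    exact absurd (Nat.cast_eq_zero.1 this) (by omega)
  have := (differentiableAt_riemannZeta h1).hasDerivAt.comp_sub_const (0 : ℂ) (j : ℂ)
  simpa using this

/-- The `k`-th term of the remainder part of the continued Barnes zeta function. -/
def barnesRemTerm (r : ℕ) (w : ℝ) (k : ℕ) (s : ℂ) : ℂ :=
  (Nat.multichoose (r + 1) k : ℂ) * (((k : ℂ) + 1) ^ (-s) * powRemainder (r + 2) s (w / (k + 1)))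

theorem differentiable_barnesRemTerm (r : ℕ) {w : ℝ} (hw : 0 ≤ w) (k : ℕ) :
    Differentiable ℂ (barnesRemTerm r w k) := by
  have hk : ((k : ℂ) + 1) ≠ 0 := Nat.cast_add_one_ne_zero k
  unfold barnesRemTerm
  refine Differentiable.const_mul (Differentiable.mul ?_ ?_) _
  · exact (differentiable_id.neg).const_cpow (Or.inl hk)
  · exact differentiable_powRemainder _ (by positivity)

theorem hasDerivAt_barnesRemTerm_zero (r : ℕ) {w : ℝ} (hw : 0 ≤ w) (k : ℕ) :
    HasDerivAt (barnesRemTerm r w k) (-((Nat.multichoose (r + 1) k : ℂ) *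
      (Complex.log (1 + (w / (k + 1) : ℝ)) - Complex.logTaylor (r + 2) ((w / (k + 1) : ℝ) : ℂ)))) 0 := by
  have hk : ((k : ℂ) + 1) ≠ 0 := Nat.cast_add_one_ne_zero k
  have h1 : DifferentiableAt ℂ (fun s : ℂ => ((k : ℂ) + 1) ^ (-s)) 0 :=
    (differentiable_id.neg).const_cpow (Or.inl hk) 0
  have h2 := hasDerivAt_powRemainder_zero (r + 2) (u := w / (k + 1)) (by positivity)
  refine ((h1.hasDerivAt.mul h2).const_mul (Nat.multichoose (r + 1) k : ℂ)).congr_deriv ?_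
  rw [powRemainder_succ_zero]
  simp
  ring

/-- This is why the expansion is cut at order `r + 2`: `k^r · k^(-re s) · k^(-r-2) = k^(-2 - re s)`
is summable as soon as `re s > -1`. -/
theorem exists_norm_barnesRemTerm_le (r : ℕ) {w : ℝ} (hw : 0 ≤ w) (δ A : ℝ) : ∃ C : ℝ,
    ∀ (k : ℕ) (s : ℂ), s ∈ {s : ℂ | -1 + δ < s.re} ∩ Metric.ball 0 A →
      ‖barnesRemTerm r w k s‖ ≤ C * ((k : ℝ) + 1) ^ (-1 - δ) := by
  obtain ⟨C, hC0, hC⟩ := exists_norm_powRemainder_le w (r + 2) A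
  refine ⟨C * w ^ (r + 2), fun k s ⟨hs1, hs2⟩ => ?_⟩
  have hk : (0 : ℝ) < (k : ℝ) + 1 := by positivity
  have hk1 : (1 : ℝ) ≤ (k : ℝ) + 1 := by linarith [Nat.cast_nonneg (α := ℝ) k]
  have hs1' : -1 + δ < s.re := hs1
  have h1 : ‖((k : ℂ) + 1) ^ (-s)‖ ≤ ((k : ℝ) + 1) ^ (1 - δ) := by
    rw [show ((k : ℂ) + 1) = ((k + 1 : ℝ) : ℂ) by push_cast; rfl,
      Complex.norm_cpow_eq_rpow_re_of_pos hk]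
    exact Real.rpow_le_rpow_of_exponent_le hk1 (by simp; linarith)
  have h2 : ‖powRemainder (r + 2) s (w / (k + 1))‖ ≤ C * (w / (k + 1)) ^ (r + 2) :=
    hC s (by simpa using (mem_ball_zero_iff.1 hs2).le) _ ⟨by positivity, div_le_self hw hk1⟩
  have h3 : (Nat.multichoose (r + 1) k : ℝ) ≤ ((k : ℝ) + 1) ^ r := by
    exact_mod_cast multichoose_succ_le r k
  rw [barnesRemTerm, norm_mul, norm_mul, Complex.norm_natCast]
  calc _ ≤ ((k : ℝ) + 1) ^ r * (((k : ℝ) + 1) ^ (1 - δ) * (C * (w / (k + 1)) ^ (r + 2))) := by gcongr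
    _ = C * w ^ (r + 2) * (((k : ℝ) + 1) ^ (1 - δ) * (((k : ℝ) + 1) ^ (2 : ℕ))⁻¹) := by
      rw [div_pow, pow_add ((k : ℝ) + 1) r 2]; field_simp
    _ = _ := by
      rw [← Real.rpow_natCast _ 2, ← Real.rpow_neg hk.le, ← Real.rpow_add hk]; congr 2; norm_num; ring

/-- The remainder part of the continued Barnes zeta function. -/
def barnesRem (r : ℕ) (w : ℝ) (s : ℂ) : ℂ := ∑' k, barnesRemTerm r w k s

theorem isOpen_halfPlane_inter_ball (δ A : ℝ) :
    IsOpen ({s : ℂ | -1 + δ < s.re} ∩ Metric.ball 0 A) :=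
  (isOpen_lt continuous_const Complex.continuous_re).inter Metric.isOpen_ball

theorem differentiableOn_barnesRem (r : ℕ) {w : ℝ} (hw : 0 ≤ w) :
    DifferentiableOn ℂ (barnesRem r w) {s : ℂ | -1 < s.re} := by
  intro s hs
  have hs' : -1 < s.re := hs
  -- With `δ = (re s + 1)/2` the point `s` lies strictly inside the region of uniform convergence.
  obtain ⟨C, hC⟩ := exists_norm_barnesRemTerm_le r hw ((s.re + 1) / 2) (‖s‖ + 1)
  have h := Complex.differentiableOn_tsum_of_summable_norm
    ((summable_natCast_succ_rpow (a := -1 - (s.re + 1) / 2) (by linarith)).mul_left C)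
    (fun k => (differentiable_barnesRemTerm r hw k).differentiableOn)
    (isOpen_halfPlane_inter_ball ((s.re + 1) / 2) (‖s‖ + 1)) hC
  refine (h.differentiableAt ((isOpen_halfPlane_inter_ball _ _).mem_nhds ⟨?_, ?_⟩)).differentiableWithinAt
  · change -1 + (s.re + 1) / 2 < s.re; linarith
  · simp

theorem hasSum_deriv_barnesRem_zero (r : ℕ) {w : ℝ} (hw : 0 ≤ w) :
    HasSum (fun k : ℕ => -((Nat.multichoose (r + 1) k : ℂ) *
      (Complex.log (1 + (w / (k + 1) : ℝ)) - Complex.logTaylor (r + 2) ((w / (k + 1) : ℝ) : ℂ))))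
      (deriv (barnesRem r w) 0) := by
  obtain ⟨C, hC⟩ := exists_norm_barnesRemTerm_le r hw (1 / 2) 1
  have h := Complex.hasSum_deriv_of_summable_norm
    ((summable_natCast_succ_rpow (a := -1 - 1 / 2) (by norm_num)).mul_left C)
    (fun k => (differentiable_barnesRemTerm r hw k).differentiableOn)
    (isOpen_halfPlane_inter_ball (1 / 2) 1) hC (z := 0) ⟨by norm_num, by simp⟩
  simp only [(hasDerivAt_barnesRemTerm_zero r hw _).deriv] at h
  exact h

/-- The continuation of Barnes' zeta function `s ↦ ∑_k multichoose(r, k) (x + k)^(-s)` to the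
half plane `-1 < re s`, for `1 ≤ x`. -/
def barnesZeta : ℕ → ℝ → ℂ → ℂ
  | 0, x, s => (x : ℂ) ^ (-s)
  | r + 1, x, s => (∑ n ∈ Finset.range (r + 2), ((x : ℂ) - 1) ^ n * taylorCoeff r n s)
      + barnesRem r (x - 1) s

theorem meromorphicOn_barnesZeta (r : ℕ) {x : ℝ} (hx : 1 ≤ x) :
    MeromorphicOn (barnesZeta r x) {s : ℂ | -1 < s.re} := by
  intro s hs
  have hopen : IsOpen {s : ℂ | -1 < s.re} := isOpen_lt continuous_const Complex.continuous_re
  cases r with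
  | zero =>
    have hx0 : (x : ℂ) ≠ 0 := by exact_mod_cast (by linarith : x ≠ 0)
    exact (((differentiable_id.neg).const_cpow (Or.inl hx0)).analyticAt s).meromorphicAt
  | succ r =>
    refine MeromorphicAt.add ?_ ?_
    · exact MeromorphicAt.fun_sum fun n _ => (MeromorphicAt.const _ _).mul (meromorphicAt_taylorCoeff r n s)
    · exact ((differentiableOn_barnesRem r (by linarith)).analyticAt (hopen.mem_nhds hs)).meromorphicAt

theorem analyticAt_barnesZeta_zero (r : ℕ) {x : ℝ} (hx : 1 ≤ x) :
    AnalyticAt ℂ (barnesZeta r x) 0 := by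
  have hopen : IsOpen {s : ℂ | -1 < s.re} := isOpen_lt continuous_const Complex.continuous_re
  cases r with
  | zero =>
    have hx0 : (x : ℂ) ≠ 0 := by exact_mod_cast (by linarith : x ≠ 0)
    exact ((differentiable_id.neg).const_cpow (Or.inl hx0)).analyticAt 0
  | succ r =>
    refine AnalyticAt.add ?_ ?_
    · exact Finset.analyticAt_fun_sum _ fun n _ => analyticAt_const.mul (analyticAt_taylorCoeff r n)
    · exact (differentiableOn_barnesRem r (by linarith)).analyticAt
        (hopen.mem_nhds (by simp : (0 : ℂ) ∈ {s : ℂ | -1 < s.re}))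

/-- Factor `(x + k)^(-s) = (k + 1)^(-s) (1 + (x - 1)/(k + 1))^(-s)`; the subtracted binomial terms
sum to the Taylor part. -/
theorem barnesZeta_eq_barnesSeries {r : ℕ} {x : ℝ} (hx : 1 ≤ x) {s : ℂ} (hs : (r : ℝ) < s.re) :
    barnesZeta r x s = barnesSeries r s x := by
  cases r with
  | zero => rw [barnesSeries_zero]; rfl
  | succ r =>
    have hr : (0 : ℝ) ≤ r := Nat.cast_nonneg r
    push_cast at hs
    have hs0 : s ≠ 0 := by rintro rfl; simp at hs; linarith
    have hw : 0 ≤ x - 1 := by linarith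
    have h1 : ∀ n ∈ Finset.range (r + 2), HasSum (fun k : ℕ => ((x : ℂ) - 1) ^ n * (negBinom n s *
        ((Nat.multichoose (r + 1) k : ℂ) * ((k : ℂ) + 1) ^ (-(s + n)))))
        (((x : ℂ) - 1) ^ n * taylorCoeff r n s) := by
      intro n _
      rw [taylorCoeff_of_ne hs0]
      refine ((hasSum_zetaSum ?_).mul_left _).mul_left _
      simp; linarith [Nat.cast_nonneg (α := ℝ) n]
    obtain ⟨C, hC⟩ := exists_norm_barnesRemTerm_le r hw 1 (‖s‖ + 1)
    have h2 : Summable fun k => barnesRemTerm r (x - 1) k s :=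
      Summable.of_norm_bounded ((summable_natCast_succ_rpow (a := -1 - 1) (by norm_num)).mul_left C)
        fun k => hC k s ⟨by simp; linarith, by simp⟩
    have h3 := (hasSum_sum h1).add h2.hasSum
    rw [barnesZeta, barnesRem, ← h3.tsum_eq, barnesSeries]
    refine tsum_congr fun k => ?_
    have hk : (0 : ℝ) < (k : ℝ) + 1 := by positivity
    have hkC : ((k : ℂ) + 1) ≠ 0 := Nat.cast_add_one_ne_zero k
    have hu : 0 ≤ (x - 1) / ((k : ℝ) + 1) := by positivity
    have h4 : ((x : ℂ) + k) ^ (-s)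
        = ((k : ℂ) + 1) ^ (-s) * (1 + ((x - 1) / ((k : ℝ) + 1) : ℝ)) ^ (-s) := by
      rw [show ((k : ℂ) + 1) = ((k + 1 : ℝ) : ℂ) by push_cast; rfl,
        show (1 + ((x - 1) / ((k : ℝ) + 1) : ℝ) : ℂ) = ((1 + (x - 1) / ((k : ℝ) + 1) : ℝ) : ℂ) by
          push_cast; rfl,
        ← Complex.mul_cpow_ofReal_nonneg hk.le (by positivity), ← Complex.ofReal_mul]
      congr 1
      have : (k + 1) * (1 + (x - 1) / ((k : ℝ) + 1)) = x + k := by field_simp; ring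
      rw [this]; push_cast; rfl
    rw [h4, barnesRemTerm, powRemainder, mul_sub, mul_sub, Finset.mul_sum, Finset.mul_sum]
    rw [← add_sub_assoc, add_sub_right_comm, add_eq_right, sub_eq_zero]
    refine Finset.sum_congr rfl fun n _ => ?_
    rw [neg_add, Complex.cpow_add _ _ hkC, Complex.cpow_neg _ (n : ℂ), Complex.cpow_natCast]
    push_cast
    rw [div_pow]
    field_simp

/-- Identity theorem for functions meromorphic on `-1 < re s` and analytic at `0`. -/
theorem eventuallyEq_nhds_zero_of_eq_of_lt_re {f g : ℂ → ℂ} {c : ℝ}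
    (hf : MeromorphicOn f {s : ℂ | -1 < s.re}) (hg : MeromorphicOn g {s : ℂ | -1 < s.re})
    (hf0 : AnalyticAt ℂ f 0) (hg0 : AnalyticAt ℂ g 0) (h : ∀ s : ℂ, c < s.re → f s = g s) :
    f =ᶠ[nhds 0] g := by
  have hconn : IsConnected {s : ℂ | -1 < s.re} :=
    ⟨⟨0, by simp⟩, (convex_halfSpace_re_gt (-1)).isPreconnected⟩
  have h1 := (hf.sub hg).exists_meromorphicOrderAt_ne_top_iff_forall_mem hconn
  -- A point lying in both half planes `re s > c` and `re s > -1`.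
  set a : ℂ := ((|c| + 1 : ℝ) : ℂ)
  have ha : meromorphicOrderAt (f - g) a = ⊤ := by
    rw [meromorphicOrderAt_eq_top_iff]
    refine Filter.Eventually.filter_mono nhdsWithin_le_nhds ?_
    filter_upwards [(isOpen_lt continuous_const Complex.continuous_re).mem_nhds
      (show a ∈ {s : ℂ | c < s.re} from by
        change c < (((|c| + 1 : ℝ) : ℂ)).re
        rw [Complex.ofReal_re]; linarith [le_abs_self c])] with s hs
    simp [h s hs]
  have h0 : meromorphicOrderAt (f - g) 0 = ⊤ := by
    by_contra hne
    refine h1.1 ⟨0, by simp, hne⟩ a ?_ ha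
    change -1 < (((|c| + 1 : ℝ) : ℂ)).re
    rw [Complex.ofReal_re]; linarith [abs_nonneg c]
  rw [meromorphicOrderAt_eq_top_iff] at h0
  have h2 : f =ᶠ[nhdsWithin 0 {0}ᶜ] g := h0.mono fun s hs => sub_eq_zero.1 hs
  exact (ContinuousAt.eventuallyEq_nhds_iff_eventuallyEq_nhdsNE hf0.continuousAt
    hg0.continuousAt).1 h2

/-! ### Difference equation and multiplication formula for Barnes' zeta function -/

theorem barnesZeta_sub_add_one_eventuallyEq (r : ℕ) {x : ℝ} (hx : 1 ≤ x) :
    (fun s => barnesZeta (r + 1) x s - barnesZeta (r + 1) (x + 1) s) =ᶠ[nhds 0] barnesZeta r x := by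
  have hx1 : 1 ≤ x + 1 := by linarith
  refine eventuallyEq_nhds_zero_of_eq_of_lt_re (c := (r : ℝ) + 1)
    ((meromorphicOn_barnesZeta _ hx).sub (meromorphicOn_barnesZeta _ hx1))
    (meromorphicOn_barnesZeta _ hx)
    ((analyticAt_barnesZeta_zero _ hx).sub (analyticAt_barnesZeta_zero _ hx1))
    (analyticAt_barnesZeta_zero _ hx) fun s hs => ?_
  have hs1 : ((r + 1 : ℕ) : ℝ) < s.re := by push_cast; exact hs
  rw [barnesZeta_eq_barnesSeries hx hs1, barnesZeta_eq_barnesSeries hx1 hs1,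
    barnesZeta_eq_barnesSeries hx (by linarith), ← barnesSeries_sub_add_one hs hx]
  push_cast; rfl

/-- The sum `∑_q g ((x + q₁ + ⋯ + q_r) / p)` over `q₁, …, q_r` in `{0, …, p - 1}`. -/
def multisum {K : Type*} [DivisionRing K] (p r : ℕ) (g : K → ℂ) (x : K) : ℂ :=
  ∑ q : Fin r → Fin p, g ((x + ∑ i, ((q i : ℕ) : K)) / p)

/-- Adding `1` to `x` raises `q₁` by one, so the sum over `q₁` telescopes. The end term `q₁ = p`
moves the argument by `p / p = 1`. -/
theorem multisum_succ_add_one_sub {p : ℕ} (hp : 0 < p) (r : ℕ) (g : ℝ → ℂ) (x : ℝ) :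
    multisum p (r + 1) g (x + 1) - multisum p (r + 1) g x
      = multisum p r (fun y => g (y + 1) - g y) x := by
  have hp0 : (p : ℝ) ≠ 0 := by exact_mod_cast hp.ne'
  have key : ∀ y : ℝ, multisum p (r + 1) g y = ∑ q : Fin r → Fin p,
      ∑ a ∈ Finset.range p, g ((y + (a + ∑ i, ((q i : ℕ) : ℝ))) / p) := by
    intro y
    rw [multisum, ← (Fin.consEquiv fun _ => Fin p).sum_comp, Fintype.sum_prod_type_right]
    refine Finset.sum_congr rfl fun q _ => ?_
    rw [← Fin.sum_univ_eq_sum_range (fun a : ℕ => g ((y + (a + ∑ i, ((q i : ℕ) : ℝ))) / p))]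
    refine Finset.sum_congr rfl fun a _ => ?_
    rw [Fin.sum_univ_succ]
    rfl
  rw [key, key, ← Finset.sum_sub_distrib, multisum]
  refine Finset.sum_congr rfl fun q _ => ?_
  set S := ∑ i, ((q i : ℕ) : ℝ)
  have := Finset.sum_range_sub (fun a : ℕ => g ((x + (a + S)) / p)) p
  rw [← Finset.sum_sub_distrib]
  have e1 : (x + ((p : ℝ) + S)) / p = (x + S) / p + 1 := by field_simp; ring
  rw [e1] at this
  simp only [Nat.cast_zero, zero_add] at this
  rw [← this]
  refine Finset.sum_congr rfl fun a _ => ?_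
  push_cast
  rw [show x + 1 + ((a : ℝ) + S) = x + ((a : ℝ) + 1 + S) by ring]

theorem one_le_add_div {p : ℕ} (hp : 0 < p) {x S : ℝ} (hx : (p : ℝ) ≤ x) (hS : 0 ≤ S) :
    1 ≤ (x + S) / p := by
  rw [le_div_iff₀ (by exact_mod_cast hp)]; linarith

/-- Induction on `r`: by the formula for `r`, the difference of the two sides is 1-periodic, and it
tends to `0`. The bound `p ≤ x` keeps all arguments at least `1`. -/
theorem multisum_barnesSeries {p : ℕ} (hp : 0 < p) {r : ℕ} {s : ℂ} (hs : (r : ℝ) < s.re) {x : ℝ}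
    (hx : (p : ℝ) ≤ x) : multisum p r (fun y : ℝ => barnesSeries r s y) x
      = (p : ℂ) ^ s * barnesSeries r s x := by
  have hp0 : (p : ℝ) ≠ 0 := by exact_mod_cast hp.ne'
  have hp1 : (1 : ℝ) ≤ p := by exact_mod_cast hp
  induction r generalizing x with
  | zero =>
    simp only [multisum, barnesSeries_zero]
    simp only [Finset.univ_eq_empty, Finset.sum_empty, add_zero, Finset.sum_const, Finset.card_univ,
      Fintype.card_unique, one_smul]
    have h1 : (x : ℂ) = ((x / p : ℝ) : ℂ) * ((p : ℝ) : ℂ) := by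
      rw [← Complex.ofReal_mul]; congr 1; field_simp
    have hpc : (p : ℂ) ≠ 0 := by exact_mod_cast hp.ne'
    conv_rhs => rw [h1]
    have hxp : 0 ≤ x / p := div_nonneg (by linarith) (by linarith)
    rw [Complex.mul_cpow_ofReal_nonneg hxp (by positivity), Complex.ofReal_natCast, mul_left_comm,
      ← Complex.cpow_add _ _ hpc]
    simp
  | succ r ih =>
    have hs' : (r : ℝ) + 1 < s.re := by simpa using hs
    set E : ℝ → ℂ := fun y => multisum p (r + 1) (fun y : ℝ => barnesSeries (r + 1) s y) y
      - (p : ℂ) ^ s * barnesSeries (r + 1) s y with hE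
    have hper : ∀ y : ℝ, (p : ℝ) ≤ y → E (y + 1) = E y := by
      intro y hy
      have h1 := multisum_succ_add_one_sub hp r (fun y : ℝ => barnesSeries (r + 1) s y) y
      have h2 : multisum p r (fun y : ℝ => barnesSeries (r + 1) s ((y + 1 : ℝ) : ℂ)
          - barnesSeries (r + 1) s y) y = - multisum p r (fun y : ℝ => barnesSeries r s y) y := by
        simp only [multisum, ← Finset.sum_neg_distrib]
        refine Finset.sum_congr rfl fun q _ => ?_
        rw [← barnesSeries_sub_add_one hs' (one_le_add_div hp hy (by positivity))]
        push_cast; ring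
      have h3 := barnesSeries_sub_add_one hs' (x := y) (by linarith)
      rw [h2, ih (by linarith) hy] at h1
      simp only [hE]
      push_cast at h1 ⊢
      linear_combination h1 + (p : ℂ) ^ s * h3
    have hperN : ∀ N : ℕ, E (x + N) = E x := by
      intro N
      induction N with
      | zero => simp
      | succ N ihN =>
        rw [← ihN, ← hper (x + N) (by linarith [Nat.cast_nonneg (α := ℝ) N])]
        push_cast; ring_nf
    -- The limit is taken along multiples of `p`, so that the divided arguments move by the integer
    -- `M`.
    have hlim : Tendsto (fun M : ℕ => E (x + ((p * M : ℕ) : ℝ))) atTop (nhds 0) := by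
      have h1 : Tendsto (fun M : ℕ => multisum p (r + 1) (fun y : ℝ => barnesSeries (r + 1) s y)
          (x + ((p * M : ℕ) : ℝ))) atTop (nhds 0) := by
        simp only [multisum]
        rw [show (0 : ℂ) = ∑ q : Fin (r + 1) → Fin p, (0 : ℂ) by simp]
        refine tendsto_finsetSum _ fun q _ => ?_
        refine (tendsto_barnesSeries_atTop hs (x := (x + ∑ i, ((q i : ℕ) : ℝ)) / p)
          (one_le_add_div hp hx (by positivity))).congr fun M => ?_
        congr 2
        push_cast
        field_simp
        ring
      have h2 : Tendsto (fun M : ℕ => (p : ℂ) ^ s * barnesSeries (r + 1) s ((x + ((p * M : ℕ) : ℝ) : ℝ) : ℂ))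
          atTop (nhds ((p : ℂ) ^ s * 0)) := by
        refine Tendsto.const_mul _ ?_
        exact (tendsto_barnesSeries_atTop hs (x := x) (by linarith)).comp
          (tendsto_id.const_mul_atTop' hp)
      simpa [hE] using h1.sub h2
    have : E x = 0 := by
      refine tendsto_nhds_unique (tendsto_const_nhds (x := E x)) (hlim.congr fun M => hperN _)
    exact sub_eq_zero.1 this

theorem multisum_barnesZeta_eventuallyEq {p : ℕ} (hp : 0 < p) (r : ℕ) {x : ℝ} (hx : (p : ℝ) ≤ x) :
    (fun s => multisum p r (fun y => barnesZeta r y s) x)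
      =ᶠ[nhds 0] fun s => (p : ℂ) ^ s * barnesZeta r x s := by
  have hp1 : (1 : ℝ) ≤ p := by exact_mod_cast hp
  have hpc : (p : ℂ) ≠ 0 := by exact_mod_cast hp.ne'
  have hpan : ∀ s : ℂ, AnalyticAt ℂ (fun s : ℂ => (p : ℂ) ^ s) s := fun s =>
    (differentiable_id.const_cpow (Or.inl hpc)).analyticAt s
  have hq : ∀ q : Fin r → Fin p, 1 ≤ (x + ∑ i, ((q i : ℕ) : ℝ)) / p := fun q =>
    one_le_add_div hp hx (by positivity)
  have hx1 := hp1.trans hx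
  simp only [multisum]
  refine eventuallyEq_nhds_zero_of_eq_of_lt_re (c := (r : ℝ))
    (fun s hs => MeromorphicAt.fun_sum fun q _ => meromorphicOn_barnesZeta r (hq q) s hs)
    (fun s hs => (hpan s).meromorphicAt.mul (meromorphicOn_barnesZeta r hx1 s hs))
    (Finset.analyticAt_fun_sum _ fun q _ => analyticAt_barnesZeta_zero r (hq q))
    ((hpan 0).mul (analyticAt_barnesZeta_zero r hx1)) fun s hs => ?_
  rw [barnesZeta_eq_barnesSeries hx1 hs, ← multisum_barnesSeries hp hs hx, multisum]
  exact Finset.sum_congr rfl fun q _ => barnesZeta_eq_barnesSeries (hq q) hs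

/-! ### The value of Barnes' zeta function at `s = 0`. -/

theorem barnesRem_zero (r : ℕ) (w : ℝ) : barnesRem r w 0 = 0 := by
  simp [barnesRem, barnesRemTerm, powRemainder_succ_zero]

theorem barnesZeta_succ_zero (r : ℕ) (x : ℝ) : barnesZeta (r + 1) x 0
    = ∑ n ∈ Finset.range (r + 2), ((x : ℂ) - 1) ^ n * taylorCoeff r n 0 := by
  rw [barnesZeta, barnesRem_zero, add_zero]

/-- At `s = 0` the remainder vanishes and a polynomial in `x` is left. By induction it satisfies the
difference equation of `(-1)^r ψ_r`, and the two agree at `x = 1`. -/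
theorem barnesZeta_zero_eq_vignerasPsi (r : ℕ) {x : ℝ} (hx : 1 ≤ x) :
    barnesZeta r x 0 = (-1) ^ r * vignerasPsi r x := by
  induction r generalizing x with
  | zero => simp [barnesZeta, vignerasPsi]
  | succ r ih =>
    obtain ⟨Q, hQ⟩ := exists_vignerasPsi_eq_eval (r + 1)
    set S : ℂ[X] := (∑ n ∈ Finset.range (r + 2), (X - C 1) ^ n * C (taylorCoeff r n 0))
      - C ((-1) ^ (r + 1)) * Q with hS
    have hSe : ∀ y : ℝ, S.eval (y : ℂ)
        = barnesZeta (r + 1) y 0 - (-1) ^ (r + 1) * vignerasPsi (r + 1) y := by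
      intro y
      rw [barnesZeta_succ_zero, hQ, hS]
      simp [eval_finsetSum]
    have hper : ∀ n : ℕ, S.eval ((n : ℂ) + 1 + 1) = S.eval ((n : ℂ) + 1) := by
      intro n
      have hn : (1 : ℝ) ≤ (n : ℝ) + 1 := by linarith [Nat.cast_nonneg (α := ℝ) n]
      have h1 := hSe (n + 1)
      have h2 := hSe (n + 1 + 1)
      have h3 := (barnesZeta_sub_add_one_eventuallyEq r hn).eq_of_nhds
      rw [ih hn] at h3
      push_cast at h1 h2 h3
      rw [h1, h2, vignerasPsi_add_one, pow_succ]
      linear_combination -h3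
    have h1 : S.eval 1 = 0 := by
      have := hSe 1
      rw [Complex.ofReal_one, vignerasPsi_one, barnesZeta_succ_zero, Finset.sum_range_succ'] at this
      rw [this, ← mul_assoc, ← mul_pow]
      simp [taylorCoeff_zero, zetaSum]
    have := hSe x
    rw [Polynomial.eval_eq_of_periodic_nat hper, h1] at this
    exact (sub_eq_zero.1 this.symm)

/-! ### The logarithms of the multiple gamma functions -/

/-- The logarithmic series in the Weierstrass product of the multiple gamma functions. -/
def logSeries (r : ℕ) (w : ℂ) : ℂ :=
  ∑' k : ℕ, (Nat.multichoose (r + 1) k : ℂ) *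
    (Complex.log (1 + w / (k + 1)) - Complex.logTaylor (r + 2) (w / (k + 1)))

/-- The logarithm of the `r`-th multiple gamma function on the right half plane. -/
def vignerasLog : ℕ → ℂ → ℂ
  | 0, z => Complex.log z
  | r + 1, z => vignerasZetaPart (r + 1) z + (-1) ^ r *
      ((∑ n ∈ Finset.range (r + 2), (z - 1) ^ n * deriv (taylorCoeff r n) 0) - logSeries r (z - 1))

theorem hasDerivAt_barnesZeta_zero (r : ℕ) {x : ℝ} (hx : 1 ≤ x) :
    HasDerivAt (barnesZeta r x) ((-1) ^ (r + 1) * (vignerasLog r x - vignerasZetaPart r x)) 0 := by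
  cases r with
  | zero =>
    have hx0 : (x : ℂ) ≠ 0 := by exact_mod_cast (by linarith : x ≠ 0)
    refine ((hasDerivAt_neg (0 : ℂ)).const_cpow (Or.inl hx0)).congr_deriv ?_
    simp [vignerasLog, vignerasZetaPart]
  | succ r =>
    have hopen : IsOpen {s : ℂ | -1 < s.re} := isOpen_lt continuous_const Complex.continuous_re
    have h1 : HasDerivAt (barnesRem r (x - 1)) (deriv (barnesRem r (x - 1)) 0) 0 :=
      ((differentiableOn_barnesRem r (by linarith)).differentiableAt
        (hopen.mem_nhds (by simp : (0 : ℂ) ∈ {s : ℂ | -1 < s.re}))).hasDerivAt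
    have h2 : HasDerivAt (fun s => ∑ n ∈ Finset.range (r + 2), ((x : ℂ) - 1) ^ n * taylorCoeff r n s)
        (∑ n ∈ Finset.range (r + 2), ((x : ℂ) - 1) ^ n * deriv (taylorCoeff r n) 0) 0 :=
      HasDerivAt.fun_sum fun n _ =>
        (analyticAt_taylorCoeff r n).differentiableAt.hasDerivAt.const_mul _
    refine (h2.add h1).congr_deriv ?_
    rw [← (hasSum_deriv_barnesRem_zero r (by linarith)).tsum_eq, tsum_neg, vignerasLog, logSeries]
    have hs : ((-1 : ℂ)) ^ r * (-1) ^ r = 1 := by rw [← mul_pow]; simp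
    push_cast
    rw [pow_add, pow_add, add_sub_cancel_left, ← mul_assoc]
    simp [hs, sub_eq_add_neg]

theorem vignerasLog_add_one_of_one_le (r : ℕ) {x : ℝ} (hx : 1 ≤ x) :
    vignerasLog (r + 1) ((x : ℂ) + 1) = vignerasLog (r + 1) x + vignerasLog r x := by
  have h1 := (hasDerivAt_barnesZeta_zero (r + 1) hx).sub
    (hasDerivAt_barnesZeta_zero (r + 1) (x := x + 1) (by linarith))
  have h2 := (h1.congr_of_eventuallyEq (barnesZeta_sub_add_one_eventuallyEq r hx).symm).unique
    (hasDerivAt_barnesZeta_zero r hx)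
  have h3 := vignerasZetaPart_add_one r x
  push_cast at h2
  have hs : ((-1 : ℂ)) ^ r * (-1) ^ r = 1 := by rw [← mul_pow]; simp
  rw [pow_add, pow_add] at h2
  linear_combination (-(-1) ^ r) * h2 + h3 + (vignerasLog (r + 1) ((x : ℂ) + 1)
    - vignerasLog (r + 1) x - vignerasLog r x - vignerasZetaPart (r + 1) (x + 1)
    + vignerasZetaPart (r + 1) x + vignerasZetaPart r x) * (-hs)

/-- The zeta part is there for this normalisation: at `z = 1` it cancels the derivative of `zetaSum`
at `0`. -/
theorem vignerasLog_one (r : ℕ) : vignerasLog r 1 = 0 := by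
  cases r with
  | zero => simp [vignerasLog]
  | succ r =>
    have hs : ((-1 : ℂ)) ^ r * (-1) ^ r = 1 := by rw [← mul_pow]; simp
    have h0 : logSeries r 0 = 0 := by simp [logSeries, Complex.logTaylor_at_zero]
    rw [vignerasLog, sub_self, h0, Finset.sum_range_succ']
    simp [taylorCoeff_zero, deriv_zetaSum_zero, vignerasZetaPart, multichooseCoeff, Finset.mul_sum,
      ← mul_assoc, hs]

/-- Differentiate the multiplication formula at `s = 0`: the factor `p^s` contributes `log p ·
ζ_r(0, x)`, hence the term with `ψ_r`. -/
theorem multisum_vignerasLog {p : ℕ} (hp : 0 < p) (r : ℕ) {x : ℝ} (hx : (p : ℝ) ≤ x) :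
    multisum p r (vignerasLog r) (x : ℂ)
      = vignerasPhi p r x - vignerasPsi r x * Complex.log p + vignerasLog r x := by
  have hp1 : (1 : ℝ) ≤ p := by exact_mod_cast hp
  have hpc : (p : ℂ) ≠ 0 := by exact_mod_cast hp.ne'
  have hx1 := hp1.trans hx
  have hq : ∀ q : Fin r → Fin p, 1 ≤ (x + ∑ i, ((q i : ℕ) : ℝ)) / p := fun q =>
    one_le_add_div hp hx (by positivity)
  have h1 : HasDerivAt (fun s => multisum p r (fun y => barnesZeta r y s) x) _ 0 :=
    HasDerivAt.fun_sum fun q _ => hasDerivAt_barnesZeta_zero r (hq q)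
  have h2 := ((hasDerivAt_id (0 : ℂ)).const_cpow (c := (p : ℂ)) (Or.inl hpc)).mul
    (hasDerivAt_barnesZeta_zero r hx1)
  have h3 := (h1.congr_of_eventuallyEq (multisum_barnesZeta_eventuallyEq hp r hx).symm).unique h2
  have hs : ((-1 : ℂ)) ^ r * (-1) ^ r = 1 := by rw [← mul_pow]; simp
  rw [barnesZeta_zero_eq_vignerasPsi r hx1, ← Finset.mul_sum, Finset.sum_sub_distrib] at h3
  rw [vignerasPhi_eq, multisum]
  push_cast at h3
  simp only [id, Complex.cpow_zero, mul_one, one_mul] at h3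
  rw [pow_succ] at h3
  set A := ∑ q : Fin r → Fin p, vignerasLog r (((x : ℂ) + ∑ i, ((q i : ℕ) : ℂ)) / p)
  set B := ∑ q : Fin r → Fin p, vignerasZetaPart r (((x : ℂ) + ∑ i, ((q i : ℕ) : ℂ)) / p)
  linear_combination (-(-1) ^ r) * h3 + (-(A - B) + vignerasLog r x - vignerasZetaPart r x
    - Complex.log p * vignerasPsi r x) * hs

/-! ### Analyticity of the logarithms on the right half plane -/

theorem isOpen_rightHalfPlane : IsOpen {z : ℂ | 0 < z.re} :=
  isOpen_lt continuous_const Complex.continuous_re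

/-- The derivative of the remainder is `(-z)^n / (1 + z)`, and `|1 + z| ≥ δ` on a convex set
containing `0` and `u`. Thus `u` may be large, unlike in the usual bound for `|u| < 1`. -/
theorem norm_log_sub_logTaylor_le_of_re (n : ℕ) {δ : ℝ} (hδ : 0 < δ) {u : ℂ} (hδ1 : δ ≤ 1)
    (hu : δ ≤ 1 + u.re) :
    ‖Complex.log (1 + u) - Complex.logTaylor (n + 1) u‖ ≤ ‖u‖ ^ (n + 1) / δ := by
  have hconv : Convex ℝ ({z : ℂ | δ - 1 ≤ z.re} ∩ Metric.closedBall 0 ‖u‖) :=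
    (convex_halfSpace_re_ge (δ - 1)).inter (convex_closedBall 0 ‖u‖)
  have key := Convex.norm_image_sub_le_of_norm_hasDerivWithin_le (𝕜 := ℂ)
    (f := fun z => Complex.log (1 + z) - Complex.logTaylor (n + 1) z)
    (f' := fun z => (-z) ^ n * (1 + z)⁻¹) (C := ‖u‖ ^ n * δ⁻¹)
    (s := {z : ℂ | δ - 1 ≤ z.re} ∩ Metric.closedBall 0 ‖u‖) (x := 0) (y := u) ?_ ?_ hconv
    ⟨by simpa using hδ1, by simp⟩ ⟨by simp; linarith, by simp⟩
  · simp only [add_zero, Complex.log_one, Complex.logTaylor_at_zero, sub_zero] at key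
    refine key.trans (le_of_eq ?_)
    rw [pow_succ]; ring
  · rintro z ⟨hz, -⟩
    have hz' : δ - 1 ≤ z.re := hz
    refine (Complex.hasDerivAt_log_sub_logTaylor n (Or.inl ?_)).hasDerivWithinAt
    simp; linarith
  · rintro z ⟨hz, hz2⟩
    have hz' : δ - 1 ≤ z.re := hz
    rw [norm_mul, norm_pow, norm_neg, norm_inv]
    have h1 : δ ≤ ‖1 + z‖ := by
      refine le_trans ?_ (Complex.re_le_norm _)
      simp; linarith
    gcongr
    simpa using hz2

/-- The `k`-th term of `logSeries r (z - 1)`. -/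
def logTerm (r k : ℕ) (z : ℂ) : ℂ :=
  (Nat.multichoose (r + 1) k : ℂ) *
    (Complex.log (1 + (z - 1) / (k + 1)) - Complex.logTaylor (r + 2) ((z - 1) / (k + 1)))

theorem div_natCast_succ_re (z : ℂ) (k : ℕ) : (z / ((k : ℂ) + 1)).re = z.re / ((k : ℝ) + 1) := by
  rw [show ((k : ℂ) + 1) = ((k + 1 : ℝ) : ℂ) by push_cast; rfl, Complex.div_ofReal_re]

theorem norm_logTerm_le (r k : ℕ) {δ A : ℝ} (hδ : 0 < δ) (hδ1 : δ ≤ 1) {z : ℂ}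
    (hz : z ∈ {z : ℂ | δ < z.re} ∩ Metric.ball 1 A) :
    ‖logTerm r k z‖ ≤ A ^ (r + 2) / δ * ((k : ℝ) + 1) ^ (-2 : ℝ) := by
  obtain ⟨hz1, hz2⟩ := hz
  have hz1' : δ < z.re := hz1
  have hk : (0 : ℝ) < (k : ℝ) + 1 := by positivity
  have hk1 : (1 : ℝ) ≤ (k : ℝ) + 1 := by linarith [Nat.cast_nonneg (α := ℝ) k]
  have hzA : ‖z - 1‖ ≤ A := (mem_ball_iff_norm.1 hz2).le
  have hu : δ ≤ 1 + ((z - 1) / ((k : ℂ) + 1)).re := by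
    rw [div_natCast_succ_re]
    -- As `δ - 1 ≤ 0`, dividing by `k + 1 ≥ 1` preserves the lower bound.
    have : δ - 1 ≤ (z - 1).re / ((k : ℝ) + 1) := by
      rw [le_div_iff₀ hk]
      have : (δ - 1) * ((k : ℝ) + 1) ≤ (δ - 1) * 1 :=
        mul_le_mul_of_nonpos_left hk1 (by linarith)
      simp; linarith
    linarith
  have h1 := norm_log_sub_logTaylor_le_of_re (r + 1) hδ hδ1 hu
  have h2 : ‖(z - 1) / ((k : ℂ) + 1)‖ ≤ A / ((k : ℝ) + 1) := by
    rw [norm_div, show ((k : ℂ) + 1) = ((k + 1 : ℝ) : ℂ) by push_cast; rfl, Complex.norm_real,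
      Real.norm_of_nonneg hk.le]
    gcongr
  have h3 : (Nat.multichoose (r + 1) k : ℝ) ≤ ((k : ℝ) + 1) ^ r := by
    exact_mod_cast multichoose_succ_le r k
  rw [logTerm, norm_mul, Complex.norm_natCast]
  calc _ ≤ ((k : ℝ) + 1) ^ r * ((A / ((k : ℝ) + 1)) ^ (r + 2) / δ) := by
        refine mul_le_mul h3 (h1.trans ?_) (norm_nonneg _) (by positivity)
        gcongr
    _ = _ := by
      rw [div_pow, Real.rpow_neg hk.le, show (2 : ℝ) = ((2 : ℕ) : ℝ) by norm_num, Real.rpow_natCast,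
        pow_add ((k : ℝ) + 1) r 2]
      field_simp

theorem one_add_div_mem_slitPlane {z : ℂ} (hz : 0 < z.re) (k : ℕ) :
    1 + (z - 1) / ((k : ℂ) + 1) ∈ Complex.slitPlane := by
  left
  have hk : (0 : ℝ) < (k : ℝ) + 1 := by positivity
  rw [Complex.add_re, div_natCast_succ_re]
  have : (z - 1).re / ((k : ℝ) + 1) = z.re / (k + 1) - 1 / (k + 1) := by simp [sub_div]
  rw [this]
  have h2 : 1 / ((k : ℝ) + 1) ≤ 1 := by rw [div_le_one hk]; linarith [Nat.cast_nonneg (α := ℝ) k]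
  have h3 : 0 < z.re / ((k : ℝ) + 1) := by positivity
  simp only [Complex.one_re]
  linarith

/-- The Taylor polynomials of the logarithm as polynomials. -/
def logTaylorPoly (n : ℕ) : ℂ[X] :=
  ∑ j ∈ Finset.range (n + 1), C ((-1) ^ (j + 1) / (j : ℂ)) * X ^ j

theorem logTaylorPoly_eval (n : ℕ) (z : ℂ) :
    (logTaylorPoly n).eval z = Complex.logTaylor (n + 1) z := by
  simp only [logTaylorPoly, Complex.logTaylor, eval_finsetSum, eval_mul, eval_C, eval_pow, eval_X]
  exact Finset.sum_congr rfl fun j _ => by ring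

theorem logTaylorPoly_natDegree_le (n : ℕ) : (logTaylorPoly n).natDegree ≤ n := by
  refine natDegree_sum_le_of_forall_le _ _ fun j hj => ?_
  refine (natDegree_C_mul_X_pow_le _ _).trans ?_
  have := Finset.mem_range.1 hj
  omega

/-- Up to a polynomial killed by `r + 2` differentiations, each term is a multiple of `log(z + k)`.
-/
theorem exists_logTerm_eq (r k : ℕ) : ∃ Q : ℂ[X], Q.natDegree ≤ r + 1 ∧ ∀ z : ℂ, 0 < z.re →
    logTerm r k z = (Nat.multichoose (r + 1) k : ℂ) * Complex.log (z + k) - Q.eval z := by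
  have hk : (0 : ℝ) < (k : ℝ) + 1 := by positivity
  have hkC : ((k : ℂ) + 1) ≠ 0 := Nat.cast_add_one_ne_zero k
  refine ⟨C (Nat.multichoose (r + 1) k : ℂ) * (C ((Real.log (k + 1) : ℝ) : ℂ)
    + (logTaylorPoly (r + 1)).comp (C ((k : ℂ) + 1)⁻¹ * (X - C 1))), ?_, fun z hz => ?_⟩
  · refine (natDegree_C_mul_le _ _).trans ((natDegree_add_le _ _).trans (max_le (by simp) ?_))
    refine natDegree_comp_le.trans ?_
    calc _ ≤ (r + 1) * 1 := by
          refine Nat.mul_le_mul (logTaylorPoly_natDegree_le _) ((natDegree_C_mul_le _ _).trans ?_)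
          rw [natDegree_X_sub_C]
      _ = _ := mul_one _
  · have h1 := Complex.log_ofReal_mul hk
      (Complex.slitPlane_ne_zero (one_add_div_mem_slitPlane hz k))
    have h2 : ((k + 1 : ℝ) : ℂ) * (1 + (z - 1) / ((k : ℂ) + 1)) = z + k := by
      push_cast; field_simp; ring
    rw [h2] at h1
    simp only [logTerm, eval_mul, eval_C, eval_add, eval_comp, logTaylorPoly_eval, eval_sub, eval_X, h1]
    rw [inv_mul_eq_div]
    ring

theorem natCast_add_mem_slitPlane {z : ℂ} (hz : 0 < z.re) (k : ℕ) : z + k ∈ Complex.slitPlane := by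
  left; simp; positivity

theorem differentiableOn_logTerm (r k : ℕ) : DifferentiableOn ℂ (logTerm r k) {z | 0 < z.re} := by
  obtain ⟨Q, -, hQ⟩ := exists_logTerm_eq r k
  refine DifferentiableOn.congr (f := fun z => (Nat.multichoose (r + 1) k : ℂ) * Complex.log (z + k)
    - Q.eval z) (fun z hz => ?_) hQ
  refine DifferentiableAt.differentiableWithinAt ?_
  refine DifferentiableAt.sub ?_ (Polynomial.differentiable Q z)
  exact ((differentiableAt_id.add_const _).clog (natCast_add_mem_slitPlane hz k)).const_mul _

theorem iteratedDeriv_polynomial_eval (n : ℕ) (Q : ℂ[X]) (z : ℂ) :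
    iteratedDeriv n (fun z => Q.eval z) z = (derivative^[n] Q).eval z := by
  induction n generalizing z with
  | zero => simp
  | succ n ih =>
    rw [iteratedDeriv_succ, funext ih, Polynomial.deriv, Function.iterate_succ_apply']

theorem iteratedDeriv_logTerm (r k : ℕ) {z : ℂ} (hz : 0 < z.re) :
    iteratedDeriv (r + 2) (logTerm r k) z
      = (-1) ^ (r + 1) * (r + 1).factorial *
        ((Nat.multichoose (r + 1) k : ℂ) * (z + k) ^ (-((r + 2 : ℕ) : ℂ))) := by
  obtain ⟨Q, hQd, hQ⟩ := exists_logTerm_eq r k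
  have h1 : logTerm r k =ᶠ[nhds z]
      fun z => (Nat.multichoose (r + 1) k : ℂ) * Complex.log (z + k) - Q.eval z := by
    filter_upwards [isOpen_rightHalfPlane.mem_nhds hz] with y hy using hQ y hy
  have h2 : ContDiffAt ℂ ((r + 2 : ℕ) : WithTop ℕ∞) (fun z : ℂ => Complex.log (z + k)) z :=
    (AnalyticAt.clog (f := fun z : ℂ => z + k) (by fun_prop)
      (natCast_add_mem_slitPlane hz k)).contDiffAt
  rw [h1.iteratedDeriv_eq, iteratedDeriv_fun_sub (contDiffAt_const.mul h2) (Polynomial.differentiable Q).contDiff.contDiffAt,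
    iteratedDeriv_polynomial_eval, iterate_derivative_eq_zero (by omega), eval_zero, sub_zero,
    iteratedDeriv_const_mul_field, congrFun (iteratedDeriv_comp_add_const (r + 2) Complex.log (k : ℂ)) z,
    iteratedDeriv_succ_log (natCast_add_mem_slitPlane hz k), Complex.cpow_neg,
    Complex.cpow_natCast, show (-((r + 1 : ℕ) : ℤ) - 1) = -((r + 2 : ℕ) : ℤ) by push_cast; ring,
    zpow_neg, zpow_natCast]
  ring

/-- Weierstrass: locally uniform limits of holomorphic functions may be differentiated repeatedly.
-/
theorem hasSum_iteratedDeriv_of_summable_norm {ι : Type*} {F : ι → ℂ → ℂ} {U : Set ℂ} {u : ι → ℝ}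
    (hu : Summable u) (hf : ∀ i, DifferentiableOn ℂ (F i) U) (hU : IsOpen U)
    (hF : ∀ i, ∀ w ∈ U, ‖F i w‖ ≤ u i) (m : ℕ) {z : ℂ} (hz : z ∈ U) :
    HasSum (fun i => iteratedDeriv m (F i) z) (iteratedDeriv m (fun w => ∑' i, F i w) z) := by
  have hfin : ∀ s : Finset ι, DifferentiableOn ℂ (fun w => ∑ i ∈ s, F i w) U := fun s =>
    DifferentiableOn.fun_sum fun i _ => hf i
  have hd : ∀ (f : ℂ → ℂ), DifferentiableOn ℂ f U → ∀ m, DifferentiableOn ℂ (iteratedDeriv m f) U := by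
    intro f hf m
    induction m with
    | zero => simpa using hf
    | succ m ih => rw [iteratedDeriv_succ]; exact ih.deriv hU
  have key : ∀ m, TendstoLocallyUniformlyOn (fun (s : Finset ι) => iteratedDeriv m fun w => ∑ i ∈ s, F i w)
      (iteratedDeriv m fun w => ∑' i, F i w) atTop U := by
    intro m
    induction m with
    | zero => simpa using (tendstoUniformlyOn_tsum hu hF).tendstoLocallyUniformlyOn
    | succ m ih =>
      simp only [iteratedDeriv_succ]
      exact ih.deriv (Eventually.of_forall fun s => hd _ (hfin s) m) hU
  refine ((key m).tendsto_at hz).congr fun s => ?_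
  exact iteratedDeriv_fun_sum fun i _ => ((hf i).analyticAt (hU.mem_nhds hz)).contDiffAt

theorem isOpen_logTerm_domain (δ A : ℝ) : IsOpen ({z : ℂ | δ < z.re} ∩ Metric.ball 1 A) :=
  (isOpen_lt continuous_const Complex.continuous_re).inter Metric.isOpen_ball

theorem exists_logTerm_domain {z : ℂ} (hz : 0 < z.re) : ∃ δ A : ℝ, 0 < δ ∧ δ ≤ 1 ∧
    z ∈ {z : ℂ | δ < z.re} ∩ Metric.ball 1 A := by
  refine ⟨min 1 (z.re / 2), ‖z - 1‖ + 1, by positivity, min_le_left _ _, ?_, ?_⟩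
  · exact (min_le_right (1 : ℝ) (z.re / 2)).trans_lt (half_lt_self hz)
  · rw [mem_ball_iff_norm]; linarith

theorem logSeries_sub_one (r : ℕ) (z : ℂ) : logSeries r (z - 1) = ∑' k, logTerm r k z := rfl

theorem differentiableAt_logSeries (r : ℕ) {z : ℂ} (hz : 0 < z.re) :
    DifferentiableAt ℂ (fun z => logSeries r (z - 1)) z := by
  obtain ⟨δ, A, hδ, hδ1, hzU⟩ := exists_logTerm_domain hz
  simp only [logSeries_sub_one]
  refine (Complex.differentiableOn_tsum_of_summable_norm
    ((summable_natCast_succ_rpow (a := -2) (by norm_num)).mul_left (A ^ (r + 2) / δ))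
    (fun k => (differentiableOn_logTerm r k).mono fun y hy => hδ.trans hy.1)
    (isOpen_logTerm_domain δ A)
    fun k y hy => norm_logTerm_le r k hδ hδ1 hy).differentiableAt
    ((isOpen_logTerm_domain δ A).mem_nhds hzU)

theorem hasSum_iteratedDeriv_logSeries (r : ℕ) {z : ℂ} (hz : 0 < z.re) :
    HasSum (fun k : ℕ => (-1) ^ (r + 1) * (r + 1).factorial *
        ((Nat.multichoose (r + 1) k : ℂ) * (z + k) ^ (-((r + 2 : ℕ) : ℂ))))
      (iteratedDeriv (r + 2) (fun z => logSeries r (z - 1)) z) := by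
  obtain ⟨δ, A, hδ, hδ1, hzU⟩ := exists_logTerm_domain hz
  simp only [logSeries_sub_one]
  simp only [← iteratedDeriv_logTerm r _ hz]
  exact hasSum_iteratedDeriv_of_summable_norm
    ((summable_natCast_succ_rpow (a := -2) (by norm_num)).mul_left (A ^ (r + 2) / δ))
    (fun k => (differentiableOn_logTerm r k).mono fun y hy => hδ.trans hy.1)
    (isOpen_logTerm_domain δ A)
    (fun k y hy => norm_logTerm_le r k hδ hδ1 hy) _ hzU

theorem exists_vignerasLog_succ_eq (r : ℕ) : ∃ Q : ℂ[X], Q.natDegree ≤ r + 1 ∧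
    ∀ z, vignerasLog (r + 1) z = Q.eval z - (-1) ^ r * logSeries r (z - 1) := by
  obtain ⟨P, hPd, hP⟩ := exists_vignerasZetaPart_eq_eval (r + 1)
  refine ⟨P + C ((-1) ^ r) * ∑ n ∈ Finset.range (r + 2), (X - C 1) ^ n * C (deriv (taylorCoeff r n) 0),
    ?_, fun z => ?_⟩
  · refine (natDegree_add_le _ _).trans (max_le hPd ((natDegree_C_mul_le _ _).trans ?_))
    refine natDegree_sum_le_of_forall_le _ _ fun n hn => (natDegree_mul_C_le _ _).trans ?_
    refine natDegree_pow_le.trans ?_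
    rw [natDegree_X_sub_C, mul_one]
    have := Finset.mem_range.1 hn
    omega
  · rw [vignerasLog, hP]
    simp [eval_finsetSum]
    ring

theorem differentiableAt_vignerasLog (r : ℕ) {z : ℂ} (hz : 0 < z.re) :
    DifferentiableAt ℂ (vignerasLog r) z := by
  cases r with
  | zero => exact Complex.differentiableAt_log (Or.inl hz)
  | succ r =>
    obtain ⟨Q, -, hQ⟩ := exists_vignerasLog_succ_eq r
    rw [show vignerasLog (r + 1) = fun z => Q.eval z - (-1) ^ r * logSeries r (z - 1) from funext hQ]
    exact (Q.differentiable z).sub ((differentiableAt_logSeries r hz).const_mul _)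

theorem analyticOnNhd_vignerasLog (r : ℕ) : AnalyticOnNhd ℂ (vignerasLog r) {z | 0 < z.re} :=
  DifferentiableOn.analyticOnNhd (fun _ hz => (differentiableAt_vignerasLog r hz).differentiableWithinAt)
    isOpen_rightHalfPlane

/-- The source of condition (iv): on the positive axis the right side is a series of nonnegative
terms. -/
theorem iteratedDeriv_vignerasLog (r : ℕ) {z : ℂ} (hz : 0 < z.re) :
    iteratedDeriv (r + 1) (vignerasLog r) z = r.factorial * barnesSeries r ((r + 1 : ℕ) : ℂ) z := by
  cases r with
  | zero =>
    have : vignerasLog 0 = Complex.log := rfl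
    rw [barnesSeries_zero, this, zero_add, iteratedDeriv_one,
      (Complex.hasDerivAt_log (Or.inl hz)).deriv]
    simp [Complex.cpow_neg_one]
  | succ r =>
    obtain ⟨Q, hQd, hQ⟩ := exists_vignerasLog_succ_eq r
    have hL : ContDiffAt ℂ ((r + 1 + 1 : ℕ) : WithTop ℕ∞) (fun z => logSeries r (z - 1)) z := by
      have : DifferentiableOn ℂ (fun z => logSeries r (z - 1)) {z | 0 < z.re} := fun y hy =>
        (differentiableAt_logSeries r hy).differentiableWithinAt
      exact (this.analyticAt (isOpen_rightHalfPlane.mem_nhds hz)).contDiffAt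
    rw [show vignerasLog (r + 1) = fun z => Q.eval z - (-1) ^ r * logSeries r (z - 1) from funext hQ,
      iteratedDeriv_fun_sub (Polynomial.differentiable Q).contDiff.contDiffAt (contDiffAt_const.mul hL),
      iteratedDeriv_polynomial_eval, iterate_derivative_eq_zero (by omega), eval_zero, zero_sub,
      iteratedDeriv_const_mul_field, ← (hasSum_iteratedDeriv_logSeries r hz).tsum_eq, tsum_mul_left,
      barnesSeries]
    have hs : ((-1 : ℂ)) ^ r * (-1) ^ r = 1 := by rw [← mul_pow]; simp
    rw [pow_succ]
    set S := ∑' k : ℕ, (Nat.multichoose (r + 1) k : ℂ) * (z + k) ^ (-((r + 2 : ℕ) : ℂ))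
    linear_combination ((r + 1).factorial * S) * hs

theorem frequently_nhdsNE_ofReal {p : ℂ → Prop} {a : ℝ} (h : ∀ x : ℝ, a < x → p x) :
    ∃ᶠ z in nhdsWithin (a : ℂ) {(a : ℂ)}ᶜ, p z := by
  have ht : Tendsto (fun x : ℝ => (x : ℂ)) (nhdsWithin a (Set.Ioi a)) (nhdsWithin (a : ℂ) {(a : ℂ)}ᶜ) := by
    refine tendsto_nhdsWithin_iff.2 ⟨Complex.continuous_ofReal.continuousAt.tendsto.mono_left
      nhdsWithin_le_nhds, ?_⟩
    filter_upwards [self_mem_nhdsWithin] with x hx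
    have hx' : a < x := hx
    simpa using hx'.ne'
  refine ht.frequently (Eventually.frequently ?_)
  filter_upwards [self_mem_nhdsWithin] with x hx using h x hx

theorem vignerasLog_add_one (r : ℕ) {z : ℂ} (hz : 0 < z.re) :
    vignerasLog (r + 1) (z + 1) = vignerasLog (r + 1) z + vignerasLog r z := by
  have h1 : AnalyticOnNhd ℂ (fun z => vignerasLog (r + 1) (z + 1)) {z | 0 < z.re} := fun y hy =>
    (analyticOnNhd_vignerasLog (r + 1) (y + 1) (by
      have hy' : 0 < y.re := hy
      change 0 < (y + 1).re
      simp; linarith)).fun_comp (f := fun z => z + 1) (by fun_prop)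
  have h2 : AnalyticOnNhd ℂ (fun z => vignerasLog (r + 1) z + vignerasLog r z) {z | 0 < z.re} :=
    (analyticOnNhd_vignerasLog (r + 1)).add (analyticOnNhd_vignerasLog r)
  exact h1.eqOn_of_preconnected_of_frequently_eq h2 (convex_halfSpace_re_gt 0).isPreconnected
    (z₀ := ((1 : ℝ) : ℂ)) (by simp)
    (frequently_nhdsNE_ofReal fun x hx => vignerasLog_add_one_of_one_le r hx.le) hz

/-! ### Reality of the logarithms on the positive axis. -/

theorem logTerm_ofReal_im (r k : ℕ) {x : ℝ} (hx : 0 < x) : (logTerm r k x).im = 0 := by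
  have hk : (0 : ℝ) < (k : ℝ) + 1 := by positivity
  have h1 : 0 < 1 + (x - 1) / ((k : ℝ) + 1) := by
    have : 1 + (x - 1) / ((k : ℝ) + 1) = (x + k) / (k + 1) := by field_simp; ring
    rw [this]; positivity
  have h2 : logTerm r k x = (((Nat.multichoose (r + 1) k : ℝ) * (Real.log (1 + (x - 1) / ((k : ℝ) + 1))
      - ∑ j ∈ Finset.range (r + 2), (-1) ^ (j + 1) * ((x - 1) / ((k : ℝ) + 1)) ^ j / j) : ℝ) : ℂ) := by
    rw [logTerm, Complex.logTaylor]
    push_cast [Complex.ofReal_log h1.le]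
    rfl
  rw [h2, Complex.ofReal_im]

/-- The logarithmic series is real, so the imaginary part comes from a polynomial. By induction that
part is periodic on positive integers, and it vanishes at `1`; reality of the constants `ζ'(-j)` is
not needed. -/
theorem vignerasLog_ofReal_im (r : ℕ) {x : ℝ} (hx : 0 < x) : (vignerasLog r x).im = 0 := by
  induction r generalizing x with
  | zero => rw [vignerasLog, ← Complex.ofReal_log hx.le, Complex.ofReal_im]
  | succ r ih =>
    obtain ⟨Q, -, hQ⟩ := exists_vignerasLog_succ_eq r
    have hser : ∀ y : ℝ, 0 < y → ((-1) ^ r * logSeries r ((y : ℂ) - 1)).im = 0 := by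
      intro y hy
      have h1 : (logSeries r ((y : ℂ) - 1)).im = 0 := by
        rw [logSeries_sub_one]
        have : ∀ k, logTerm r k y = (((logTerm r k y).re : ℝ) : ℂ) := fun k =>
          Complex.ext (by simp) (by simp [logTerm_ofReal_im r k hy])
        rw [tsum_congr this, ← Complex.ofReal_tsum, Complex.ofReal_im]
      rcases neg_one_pow_eq_or ℂ r with h | h <;> simp [h, h1]
    have him : ∀ y : ℝ, 0 < y → (vignerasLog (r + 1) y).im = (Q.eval (y : ℂ)).im := fun y hy => by
      rw [hQ, Complex.sub_im, hser y hy, sub_zero]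
    set S : ℂ[X] := Q - Q.map (starRingEnd ℂ) with hS
    have hSe : ∀ y : ℝ, 0 < y → S.eval (y : ℂ) = 2 * (vignerasLog (r + 1) y).im * Complex.I := by
      intro y hy
      have h1 : (Q.map (starRingEnd ℂ)).eval (y : ℂ) = (starRingEnd ℂ) (Q.eval (y : ℂ)) := by
        conv_lhs => rw [← Complex.conj_ofReal y]
        rw [eval_map, eval₂_hom]
      rw [hS, eval_sub, h1, him y hy, Complex.sub_conj]
      push_cast; ring
    have hper : ∀ n : ℕ, S.eval ((n : ℂ) + 1 + 1) = S.eval ((n : ℂ) + 1) := by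
      intro n
      have hn : (0 : ℝ) < (n : ℝ) + 1 := by positivity
      have h1 := hSe (n + 1) hn
      have h2 := hSe (n + 1 + 1) (by positivity)
      have h3 := vignerasLog_add_one r (z := ((n + 1 : ℝ) : ℂ)) (by simpa using hn)
      have h4 := congrArg Complex.im h3
      rw [Complex.add_im, ih hn, add_zero] at h4
      push_cast at h1 h2 h4
      rw [h1, h2, h4]
    have h1 := hSe 1 one_pos
    have h2 := hSe x hx
    rw [Polynomial.eval_eq_of_periodic_nat hper, ← Complex.ofReal_one, h1, Complex.ofReal_one, vignerasLog_one] at h2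
    simpa using h2.symm

/-! ### The multiple gamma functions on the whole plane -/

/-- The multiple gamma functions of Vignéras. -/
def vignerasG : ℕ → ℂ → ℂ
  | 0, z => z
  | r + 1, z => Complex.exp (vignerasLog (r + 1) (z + (⌊-z.re⌋₊ + 1 : ℕ)))
      / ∏ k ∈ Finset.range (⌊-z.re⌋₊ + 1), vignerasG r (z + k)

theorem vignerasG_eq_exp (r : ℕ) {z : ℂ} (hz : 0 < z.re) :
    vignerasG r z = Complex.exp (vignerasLog r z) := by
  induction r with
  | zero =>
    have : z ≠ 0 := by rintro rfl; simp at hz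
    rw [vignerasG, vignerasLog, Complex.exp_log this]
  | succ r ih =>
    have hfl : ⌊-z.re⌋₊ = 0 := Nat.floor_of_nonpos (by linarith)
    rw [vignerasG, hfl]
    simp [vignerasLog_add_one r hz, ih, Complex.exp_add]

/-- Any shift into the right half plane gives the same quotient; `⌊-z.re⌋₊ + 1` in the definition is
merely one such shift. -/
theorem exp_vignerasLog_div_prod_eq (r : ℕ) {z : ℂ} {M N : ℕ} (hM : 0 < z.re + M) (hMN : M ≤ N) :
    Complex.exp (vignerasLog (r + 1) (z + N)) / ∏ k ∈ Finset.range N, vignerasG r (z + k)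
      = Complex.exp (vignerasLog (r + 1) (z + M)) / ∏ k ∈ Finset.range M, vignerasG r (z + k) := by
  induction N, hMN using Nat.le_induction with
  | base => rfl
  | succ N hN ih =>
    have hre : 0 < (z + N).re := by
      have : (M : ℝ) ≤ N := by exact_mod_cast hN
      simp; linarith
    rw [← ih, Finset.prod_range_succ, vignerasG_eq_exp r hre, Nat.cast_succ, ← add_assoc,
      vignerasLog_add_one r hre, Complex.exp_add, mul_div_mul_right _ _ (Complex.exp_ne_zero _)]

theorem vignerasG_succ_eq (r : ℕ) {z : ℂ} {N : ℕ} (hN : 0 < z.re + N) :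
    vignerasG (r + 1) z
      = Complex.exp (vignerasLog (r + 1) (z + N)) / ∏ k ∈ Finset.range N, vignerasG r (z + k) := by
  have hn : 0 < z.re + (⌊-z.re⌋₊ + 1 : ℕ) := by
    have := Nat.lt_floor_add_one (-z.re)
    push_cast; linarith
  rw [vignerasG]
  rcases le_total N (⌊-z.re⌋₊ + 1) with h | h
  · exact exp_vignerasLog_div_prod_eq r hN h
  · exact (exp_vignerasLog_div_prod_eq r hn h).symm

/-- In quotient form the functional equation holds at every point. The product form can fail at
poles, whose value is `0`. -/
theorem vignerasG_succ_eq_div (r : ℕ) (z : ℂ) :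
    vignerasG (r + 1) z = vignerasG (r + 1) (z + 1) / vignerasG r z := by
  obtain ⟨N, hN⟩ := exists_nat_gt (-z.re)
  rw [vignerasG_succ_eq r (z := z) (N := N + 1) (by push_cast; linarith),
    vignerasG_succ_eq r (z := z + 1) (N := N) (by simp; linarith), Finset.prod_range_succ', div_div]
  push_cast
  simp only [add_zero, add_assoc, add_comm (1 : ℂ)]

theorem vignerasG_analyticAt_and_ne_zero (r : ℕ) {z : ℂ} (hz : ∀ n : ℕ, z ≠ -n) :
    AnalyticAt ℂ (vignerasG r) z ∧ vignerasG r z ≠ 0 := by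
  induction r generalizing z with
  | zero =>
    have : vignerasG 0 = fun z => z := by ext; rw [vignerasG]
    rw [this]
    exact ⟨analyticAt_id, by simpa using hz 0⟩
  | succ r ih =>
    have hk : ∀ k n : ℕ, z + k ≠ -n := fun k n h => hz (n + k) (by push_cast; linear_combination h)
    obtain ⟨N, hN⟩ := exists_nat_gt (-z.re)
    have hN' : 0 < z.re + N := by linarith
    have hev : vignerasG (r + 1) =ᶠ[nhds z] fun z =>
        Complex.exp (vignerasLog (r + 1) (z + N)) / ∏ k ∈ Finset.range N, vignerasG r (z + k) := by
      have : IsOpen {z : ℂ | 0 < z.re + N} :=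
        isOpen_lt continuous_const (Complex.continuous_re.add continuous_const)
      filter_upwards [this.mem_nhds hN'] with y hy using vignerasG_succ_eq r hy
    have hprod : ∏ k ∈ Finset.range N, vignerasG r (z + k) ≠ 0 :=
      Finset.prod_ne_zero_iff.2 fun k _ => (ih (hk k)).2
    refine ⟨?_, ?_⟩
    · rw [analyticAt_congr hev]
      refine AnalyticAt.div ?_ (Finset.analyticAt_fun_prod _ fun k _ => ?_) hprod
      · exact AnalyticAt.cexp ((analyticOnNhd_vignerasLog (r + 1) (z + N) (by
          change 0 < (z + N).re
          simpa using hN')).fun_comp (f := fun z : ℂ => z + N) (by fun_prop))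
      · exact (ih (hk k)).1.fun_comp (f := fun z : ℂ => z + k) (by fun_prop)
    · rw [hev.eq_of_nhds]
      exact div_ne_zero (Complex.exp_ne_zero _) hprod

theorem multichoose_succ_pos (r n : ℕ) : 0 < Nat.multichoose (r + 1) n := by
  rw [Nat.multichoose_eq]
  exact Nat.choose_pos (by omega)

/-- Local factorisations must hold at the centre too. At `x = 0` the case `a = b ≠ 0` would fail,
since `0 / 0 = 0` but `0^0 = 1`. -/
theorem zpow_div_zpow_of_sub_ne_zero {a b : ℤ} (hab : a - b ≠ 0) (x : ℂ) :
    x ^ a / x ^ b = x ^ (a - b) := by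
  rcases eq_or_ne x 0 with rfl | hx
  · rw [zero_zpow _ hab]
    rcases eq_or_ne a 0 with rfl | ha
    · rw [zero_zpow b (by simpa using hab), div_zero]
    · rw [zero_zpow a ha, zero_div]
  · rw [zpow_sub₀ hx]

/-- The order of the `r`-th multiple gamma function at `-n`. -/
def vignerasOrder (r n : ℕ) : ℤ := (-1) ^ r * (Nat.multichoose r n : ℤ)

theorem vignerasOrder_succ_ne_zero (r n : ℕ) : vignerasOrder (r + 1) n ≠ 0 :=
  mul_ne_zero (pow_ne_zero _ (by norm_num)) (by exact_mod_cast (multichoose_succ_pos r n).ne')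

/-- Orders at `-n` follow from the quotient equation by induction on `r` and then `n`, starting from
`G_{r+1}(1) ≠ 0`. -/
theorem vignerasG_local_form (r n : ℕ) : ∃ h : ℂ → ℂ, AnalyticAt ℂ h (-n) ∧ h (-n) ≠ 0 ∧
    vignerasG r =ᶠ[nhds (-(n : ℂ))] fun z => (z - -n) ^ vignerasOrder r n * h z := by
  induction r generalizing n with
  | zero =>
    cases n with
    | zero => exact ⟨fun _ => 1, analyticAt_const, one_ne_zero, Eventually.of_forall fun z => by
        simp [vignerasG, vignerasOrder]⟩
    | succ n =>
      refine ⟨fun z => z, analyticAt_id, ?_, Eventually.of_forall fun z => by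
        simp [vignerasG, vignerasOrder, Nat.multichoose_zero_succ]⟩
      exact neg_ne_zero.2 (Nat.cast_ne_zero.2 (Nat.succ_ne_zero n))
  | succ r ih =>
    have hdiv : vignerasG (r + 1) = fun z => vignerasG (r + 1) (z + 1) / vignerasG r z :=
      funext (vignerasG_succ_eq_div r)
    induction n with
    | zero =>
      obtain ⟨g, hg, hg0, hgev⟩ := ih 0
      have h1 := vignerasG_analyticAt_and_ne_zero (r + 1) (z := 1) (fun n h => by
        have : ((n + 1 : ℕ) : ℂ) = 0 := by push_cast; linear_combination h
        exact absurd (Nat.cast_eq_zero.1 this) (by omega))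
      simp only [Nat.cast_zero, neg_zero] at hg hg0 hgev ⊢
      refine ⟨fun z => vignerasG (r + 1) (z + 1) / g z, ?_, ?_, ?_⟩
      · refine AnalyticAt.div ?_ hg hg0
        refine AnalyticAt.fun_comp (g := vignerasG (r + 1)) (f := fun z : ℂ => z + 1) ?_ (by fun_prop)
        simpa using h1.1
      · simpa using ⟨h1.2, hg0⟩
      · filter_upwards [hgev] with z hz
        rw [congrFun hdiv z, hz]
        have hord : vignerasOrder (r + 1) 0 = - vignerasOrder r 0 := by
          simp [vignerasOrder, pow_succ]
        rw [hord, zpow_neg]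
        ring
    | succ n ihn =>
      obtain ⟨f, hf, hf0, hfev⟩ := ihn
      obtain ⟨g, hg, hg0, hgev⟩ := ih (n + 1)
      have hord : vignerasOrder (r + 1) (n + 1) = vignerasOrder (r + 1) n - vignerasOrder r (n + 1) := by
        simp only [vignerasOrder, Nat.multichoose_succ_succ, pow_succ]
        push_cast; ring
      have hpt : -((n + 1 : ℕ) : ℂ) + 1 = -n := by push_cast; ring
      have hcont : Tendsto (fun z : ℂ => z + 1) (nhds (-((n + 1 : ℕ) : ℂ))) (nhds (-(n : ℂ))) := by
        have : Tendsto (fun z : ℂ => z + 1) (nhds (-((n + 1 : ℕ) : ℂ)))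
            (nhds (-((n + 1 : ℕ) : ℂ) + 1)) := (continuous_id.add continuous_const).tendsto _
        rwa [hpt] at this
      refine ⟨fun z => f (z + 1) / g z, ?_, ?_, ?_⟩
      · refine AnalyticAt.div ?_ hg hg0
        refine AnalyticAt.fun_comp (g := f) (f := fun z : ℂ => z + 1) ?_ (by fun_prop)
        rwa [hpt]
      · refine div_ne_zero ?_ hg0
        rwa [hpt]
      · filter_upwards [hgev, hcont.eventually hfev] with z hz hz1
        rw [congrFun hdiv z, hz, hz1, hord,
          ← zpow_div_zpow_of_sub_ne_zero (hord ▸ vignerasOrder_succ_ne_zero r (n + 1))]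
        have : z + 1 - -(n : ℂ) = z - -((n + 1 : ℕ) : ℂ) := by push_cast; ring
        rw [this, mul_div_mul_comm]

/-- The order at `-n` is nonzero, so the value is `0` at zeros and poles alike. -/
theorem vignerasG_succ_neg_natCast (r n : ℕ) : vignerasG (r + 1) (-n) = 0 := by
  obtain ⟨h, -, -, hev⟩ := vignerasG_local_form (r + 1) n
  rw [hev.eq_of_nhds]
  simp [zero_zpow _ (vignerasOrder_succ_ne_zero r n)]

theorem meromorphicNFAt_vignerasG (r : ℕ) (z : ℂ) : MeromorphicNFAt (vignerasG r) z := by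
  by_cases hz : ∃ n : ℕ, z = -n
  · obtain ⟨n, rfl⟩ := hz
    obtain ⟨h, h1, h2, h3⟩ := vignerasG_local_form r n
    exact Or.inr ⟨vignerasOrder r n, h, h1, h2, h3⟩
  · push Not at hz
    exact (vignerasG_analyticAt_and_ne_zero r hz).1.meromorphicNFAt

theorem ne_neg_natCast_of_re_pos {z : ℂ} (hz : 0 < z.re) (n : ℕ) : z ≠ -n := by
  rintro rfl
  simp at hz
  linarith [Nat.cast_nonneg (α := ℝ) n]

/-- The order is `0` at `1`, hence finite everywhere by connectedness of the plane. -/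
theorem eventually_codiscrete_vignerasG_ne_zero (r : ℕ) :
    ∀ᶠ z in codiscrete ℂ, vignerasG r z ≠ 0 := by
  have hm : Meromorphic (vignerasG r) := fun z => (meromorphicNFAt_vignerasG r z).meromorphicAt
  have h1 := vignerasG_analyticAt_and_ne_zero r (ne_neg_natCast_of_re_pos (z := 1) (by simp))
  have h2 : meromorphicOrderAt (vignerasG r) 1 ≠ ⊤ := by
    rw [(h1.1.meromorphicNFAt.meromorphicOrderAt_eq_zero_iff).2 h1.2]
    exact WithTop.zero_ne_top
  have h3 := hm.exists_meromorphicOrderAt_ne_top_iff_forall.1 ⟨1, h2⟩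
  exact MeromorphicAt.MeromorphicOn.codiscreteWithin_setOfPred_ne_zero (U := Set.univ) (fun z _ => hm z) fun z _ => h3 z

/-! ### Verification of the conditions on the real axis. -/

theorem vignerasG_ofReal_add_one (r : ℕ) {t : ℝ} (ht : -1 < t) :
    vignerasG r (t + 1) = ((Real.exp (vignerasLog r (t + 1)).re : ℝ) : ℂ) := by
  have ht' : 0 < t + 1 := by linarith
  have h := vignerasLog_ofReal_im r ht'
  push_cast at h
  rw [vignerasG_eq_exp r (by simpa using ht'), Complex.ofReal_exp]
  congr 1
  exact Complex.ext (by simp) (by simp [h])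

theorem iteratedDeriv_re_comp_ofReal_add_one {f : ℂ → ℂ} (hf : AnalyticOnNhd ℂ f {z | 0 < z.re})
    (n : ℕ) {t : ℝ} (ht : -1 < t) :
    iteratedDeriv n (fun t : ℝ => (f (t + 1)).re) t = (iteratedDeriv n f (t + 1)).re := by
  induction n generalizing t with
  | zero => simp
  | succ n ih =>
    have hev : iteratedDeriv n (fun t : ℝ => (f (t + 1)).re)
        =ᶠ[nhds t] fun t : ℝ => (iteratedDeriv n f (t + 1)).re := by
      filter_upwards [isOpen_Ioi.mem_nhds ht] with y hy using ih hy
    rw [iteratedDeriv_succ, hev.deriv_eq, iteratedDeriv_succ]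
    have hd : AnalyticAt ℂ (iteratedDeriv n f) (t + 1) := by
      rw [iteratedDeriv_eq_iterate]
      exact hf.iterated_deriv n _ (by simp; linarith : ((t : ℂ) + 1) ∈ {z : ℂ | 0 < z.re})
    have h1 : HasDerivAt (fun z : ℂ => iteratedDeriv n f (z + 1)) (deriv (iteratedDeriv n f) (t + 1)) (t : ℂ) :=
      HasDerivAt.comp_add_const (t : ℂ) 1 hd.differentiableAt.hasDerivAt
    exact h1.real_of_complex.deriv

theorem iteratedDeriv_log_vignerasG (r n : ℕ) {t : ℝ} (ht : -1 < t) :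
    iteratedDeriv n (fun t : ℝ => Real.log (vignerasG r (t + 1)).re) t
      = (iteratedDeriv n (vignerasLog r) (t + 1)).re := by
  rw [← iteratedDeriv_re_comp_ofReal_add_one (analyticOnNhd_vignerasLog r) n ht]
  refine Filter.EventuallyEq.iteratedDeriv_eq n ?_
  filter_upwards [isOpen_Ioi.mem_nhds ht] with y hy
  rw [vignerasG_ofReal_add_one r hy, Complex.ofReal_re, Real.log_exp]

theorem barnesSeries_natCast_ofReal (r m : ℕ) (x : ℝ) :
    barnesSeries r (m : ℂ) x = ((∑' k : ℕ, (Nat.multichoose r k : ℝ) * ((x + k) ^ m)⁻¹ : ℝ) : ℂ) := by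
  rw [barnesSeries, Complex.ofReal_tsum]
  refine tsum_congr fun k => ?_
  rw [Complex.cpow_neg, Complex.cpow_natCast]
  push_cast; rfl

theorem isVignerasGamma_vignerasG : IsVignerasGamma vignerasG where
  meromorphic r z _ := meromorphicNFAt_vignerasG r z
  zero_eq z := by rw [vignerasG]
  map_one r := by rw [vignerasG_eq_exp r (by simp), vignerasLog_one, Complex.exp_zero]
  functional_eq r := by
    filter_upwards [eventually_codiscrete_vignerasG_ne_zero r] with z hz
    rw [vignerasG_succ_eq_div r z]
    field_simp
  pos r x hx := by
    rw [vignerasG_ofReal_add_one r (by linarith), Complex.ofReal_re, Complex.ofReal_im]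
    exact ⟨Real.exp_pos _, rfl⟩
  deriv_log_nonneg r x hx := by
    rw [iteratedDeriv_log_vignerasG r _ (by linarith),
      iteratedDeriv_vignerasLog r (by simp; linarith : 0 < ((x : ℂ) + 1).re),
      show ((x : ℂ) + 1) = ((x + 1 : ℝ) : ℂ) by push_cast; rfl, barnesSeries_natCast_ofReal,
      ← Complex.ofReal_natCast, ← Complex.ofReal_mul, Complex.ofReal_re]
    exact mul_nonneg (Nat.cast_nonneg _) (tsum_nonneg fun k => by positivity)

/-! ### A uniqueness theorem of Bohr–Mollerup type -/

theorem AnalyticOnNhd.iteratedDeriv_of_real {f : ℝ → ℝ} {s : Set ℝ} (hf : AnalyticOnNhd ℝ f s) (n : ℕ) :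
    AnalyticOnNhd ℝ (iteratedDeriv n f) s := by
  rw [iteratedDeriv_eq_iterate]
  exact hf.iterated_deriv n

theorem iteratedDeriv_add_one_of_eq_add {f φ : ℝ → ℝ} (hf : AnalyticOnNhd ℝ f (Set.Ioi 0))
    (hφ : AnalyticOnNhd ℝ φ (Set.Ioi 0)) (h : ∀ t, 0 < t → f (t + 1) = f t + φ t) (n : ℕ) {t : ℝ}
    (ht : 0 < t) : iteratedDeriv n f (t + 1) = iteratedDeriv n f t + iteratedDeriv n φ t := by
  have hev : (fun t => f (t + 1)) =ᶠ[nhds t] fun t => f t + φ t := by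
    filter_upwards [isOpen_Ioi.mem_nhds ht] with y hy using h y hy
  have := hev.iteratedDeriv_eq n
  rwa [congrFun (iteratedDeriv_comp_add_const n f 1) t,
    iteratedDeriv_fun_add (hf t ht).contDiffAt (hφ t ht).contDiffAt] at this

theorem eq_of_hasDerivAt_zero_on_Ioi {q : ℝ → ℝ} (h : ∀ t, 0 < t → HasDerivAt q 0 t) {x y : ℝ}
    (hx : 0 < x) (hy : 0 < y) : q x = q y := by
  refine (convex_Ioi (0 : ℝ)).is_const_of_fderivWithin_eq_zero (𝕜 := ℝ) (f := q)
    (fun t ht => (h t ht).differentiableAt.differentiableWithinAt) (fun t ht => ?_) hx hy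
  have := ((h t ht).hasFDerivAt.hasFDerivWithinAt (s := Set.Ioi 0)).fderivWithin
    (isOpen_Ioi.uniqueDiffWithinAt ht)
  rw [this]; ext; simp

/-- Descend in `k`: if the derivative of order `k + 1` is a constant `c`, the one of order `k` is
affine with slope `c` and periodic, so `c = 0`. -/
theorem exists_eq_const_of_periodic_of_iteratedDeriv {h : ℝ → ℝ} (hh : AnalyticOnNhd ℝ h (Set.Ioi 0))
    (hper : ∀ t, 0 < t → h (t + 1) = h t) (k : ℕ)
    (hk : ∃ c, ∀ t, 0 < t → iteratedDeriv k h t = c) : ∃ c, ∀ t, 0 < t → h t = c := by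
  induction k with
  | zero => simpa using hk
  | succ k ih =>
    obtain ⟨c, hc⟩ := hk
    have hq : ∀ t, 0 < t → HasDerivAt (iteratedDeriv k h) c t := fun t ht => by
      rw [← hc t ht, iteratedDeriv_succ]
      exact (hh.iteratedDeriv_of_real k t ht).differentiableAt.hasDerivAt
    have hqper : iteratedDeriv k h (1 + 1) = iteratedDeriv k h 1 := by
      have := iteratedDeriv_add_one_of_eq_add (φ := fun _ => 0) hh analyticOnNhd_const
        (fun t ht => by rw [hper t ht, add_zero]) k one_pos
      rw [this]
      simp
    have h1 : ∀ t, 0 < t → HasDerivAt (fun t => iteratedDeriv k h t - c * t) 0 t := fun t ht => by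
      refine ((hq t ht).sub ((hasDerivAt_id t).const_mul c)).congr_deriv ?_
      simp
    have h2 := eq_of_hasDerivAt_zero_on_Ioi h1 (x := 1) (y := 1 + 1) one_pos (by norm_num)
    simp only [hqper] at h2
    have hc0 : c = 0 := by linarith
    subst hc0
    exact ih ⟨_, fun t ht => eq_of_hasDerivAt_zero_on_Ioi hq ht one_pos⟩

/-- After a shift by `N`, monotonicity gives `v(x+N) ≤ v(y+N)` and `u(y+N) ≤ u(x+N+1) = u(x+N) +
ψ(x+N)`. As `u - v` is periodic, letting `N → ∞` suffices. -/
theorem sub_le_of_monotone_of_tendsto {u v ψ : ℝ → ℝ} (hu : MonotoneOn u (Set.Ioi 0))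
    (hv : MonotoneOn v (Set.Ioi 0)) (hu1 : ∀ t, 0 < t → u (t + 1) = u t + ψ t)
    (hv1 : ∀ t, 0 < t → v (t + 1) = v t + ψ t)
    (hψ : ∀ t, 0 < t → Tendsto (fun N : ℕ => ψ (t + N)) atTop (nhds 0)) {x y : ℝ} (hx : 0 < x)
    (hxy : x ≤ y) (hy : y ≤ x + 1) : u y - v y ≤ u x - v x := by
  have hshift : ∀ t, 0 < t → ∀ N : ℕ, u (t + N) - v (t + N) = u t - v t := by
    intro t ht N
    induction N with
    | zero => simp
    | succ N ih =>
      have : 0 < t + N := by positivity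
      rw [Nat.cast_succ, ← add_assoc, hu1 _ this, hv1 _ this, ← ih]; ring
  have key : ∀ N : ℕ, (u y - v y) - (u x - v x) ≤ ψ (x + N) := by
    intro N
    have hxN : 0 < x + N := by positivity
    rw [← hshift y (by linarith) N, ← hshift x hx N]
    have h1 := hv (Set.mem_Ioi.2 hxN) (Set.mem_Ioi.2 (by linarith : 0 < y + N)) (by linarith)
    have h2 := hu (Set.mem_Ioi.2 (by linarith : 0 < y + N))
      (Set.mem_Ioi.2 (by linarith : 0 < x + N + 1)) (by linarith)
    rw [hu1 _ hxN] at h2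
    linarith
  have := ge_of_tendsto' (hψ x hx) key
  linarith

/-- The Bohr–Mollerup step: the previous bound, used with `f` and `g` in both roles, makes the
difference of the derivatives of order `n` constant. Periodicity of `f - g` then makes `f - g`
itself constant. -/
theorem exists_sub_eq_const_of_difference_equation {f g φ : ℝ → ℝ} {n : ℕ}
    (hf : AnalyticOnNhd ℝ f (Set.Ioi 0)) (hg : AnalyticOnNhd ℝ g (Set.Ioi 0))
    (hφ : AnalyticOnNhd ℝ φ (Set.Ioi 0)) (hf1 : ∀ t, 0 < t → f (t + 1) = f t + φ t)
    (hg1 : ∀ t, 0 < t → g (t + 1) = g t + φ t)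
    (hfn : ∀ t, 0 < t → 0 ≤ iteratedDeriv (n + 1) f t)
    (hgn : ∀ t, 0 < t → 0 ≤ iteratedDeriv (n + 1) g t)
    (hφn : ∀ t, 0 < t → Tendsto (fun N : ℕ => iteratedDeriv n φ (t + N)) atTop (nhds 0)) :
    ∃ c, ∀ t, 0 < t → f t - g t = c := by
  have hmono : ∀ f : ℝ → ℝ, AnalyticOnNhd ℝ f (Set.Ioi 0) →
      (∀ t, 0 < t → 0 ≤ iteratedDeriv (n + 1) f t) → MonotoneOn (iteratedDeriv n f) (Set.Ioi 0) := by
    intro f hf hn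
    have hd := hf.iteratedDeriv_of_real n
    refine monotoneOn_of_deriv_nonneg (convex_Ioi 0) hd.continuousOn ?_ ?_
    · rw [interior_Ioi]; exact hd.differentiableOn
    · rw [interior_Ioi]
      intro t ht
      rw [← iteratedDeriv_succ]
      exact hn t ht
  have hu1 := fun t ht => iteratedDeriv_add_one_of_eq_add hf hφ hf1 n (t := t) ht
  have hv1 := fun t ht => iteratedDeriv_add_one_of_eq_add hg hφ hg1 n (t := t) ht
  set w : ℝ → ℝ := fun t => iteratedDeriv n f t - iteratedDeriv n g t with hw
  have hloc : ∀ x y, 0 < x → x ≤ y → y ≤ x + 1 → w y = w x := by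
    intro x y hx hxy hy
    have h1 := sub_le_of_monotone_of_tendsto (hmono f hf hfn) (hmono g hg hgn) hu1 hv1 hφn hx hxy hy
    have h2 := sub_le_of_monotone_of_tendsto (hmono g hg hgn) (hmono f hf hfn) hv1 hu1 hφn hx hxy hy
    simp only [hw]; linarith
  have hstep : ∀ N : ℕ, ∀ x y : ℝ, 0 < x → x ≤ y → y ≤ x + N → w y = w x := by
    intro N
    induction N with
    | zero => intro x y _ h1 h2; rw [le_antisymm (by simpa using h2) h1]
    | succ N ih =>
      intro x y hx hxy hy
      rcases le_total y (x + 1) with h | h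
      · exact hloc x y hx hxy h
      · rw [ih (x + 1) y (by linarith) h (by push_cast at hy; linarith),
          hloc x (x + 1) hx (by linarith) le_rfl]
  have hconst : ∀ x y, 0 < x → x ≤ y → w y = w x := fun x y hx hxy => by
    obtain ⟨N, hN⟩ := exists_nat_ge (y - x)
    exact hstep N x y hx hxy (by linarith)
  have hsub : AnalyticOnNhd ℝ (fun t => f t - g t) (Set.Ioi 0) := hf.sub hg
  refine exists_eq_const_of_periodic_of_iteratedDeriv hsub
    (fun t ht => by rw [hf1 t ht, hg1 t ht]; ring) n ⟨w 1, fun t ht => ?_⟩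
  rw [iteratedDeriv_fun_sub (hf t ht).contDiffAt (hg t ht).contDiffAt]
  change w t = w 1
  rcases le_total t 1 with h | h
  · exact (hconst t 1 ht h).symm
  · exact hconst 1 t one_pos h

/-! ### Uniqueness of the multiple gamma functions -/

theorem eventuallyEq_nhdsNE_of_frequently_eq {f g : ℂ → ℂ} (hf : Meromorphic f) (hg : Meromorphic g)
    {a : ℂ} (h : ∃ᶠ z in nhdsWithin a {a}ᶜ, f z = g z) (z : ℂ) :
    f =ᶠ[nhdsWithin z {z}ᶜ] g := by
  have hm : Meromorphic (f - g) := fun z => (hf z).sub (hg z)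
  have h1 : meromorphicOrderAt (f - g) a = ⊤ := by
    rw [meromorphicOrderAt_eq_top_iff]
    exact ((MeromorphicAt.frequently_eq_iff_eventuallyEq (hf a) (hg a)).1 h).mono fun z hz =>
      sub_eq_zero.2 hz
  have h2 : meromorphicOrderAt (f - g) z = ⊤ := by
    by_contra hne
    exact hm.exists_meromorphicOrderAt_ne_top_iff_forall.1 ⟨z, hne⟩ a h1
  rw [meromorphicOrderAt_eq_top_iff] at h2
  exact h2.mono fun y hy => sub_eq_zero.1 hy

namespace IsVignerasGamma

variable {G : ℕ → ℂ → ℂ}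

theorem ofReal_eq (hG : IsVignerasGamma G) (r : ℕ) {x : ℝ} (hx : 0 ≤ x) :
    G r (x + 1) = (((G r (x + 1)).re : ℝ) : ℂ) :=
  Complex.ext (by simp) (by simpa using (hG.pos r x hx).2)

/-- In normal form, a nonzero value forces order `0`. -/
theorem analyticAt (hG : IsVignerasGamma G) (r : ℕ) {x : ℝ} (hx : 0 ≤ x) :
    AnalyticAt ℂ (G r) (x + 1) := by
  have hnf : MeromorphicNFAt (G r) (x + 1) := hG.meromorphic r (Set.mem_univ _)
  have hne : G r (x + 1) ≠ 0 := by
    rw [hG.ofReal_eq r hx]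
    exact_mod_cast (hG.pos r x hx).1.ne'
  exact hnf.meromorphicOrderAt_nonneg_iff_analyticAt.1
    (hnf.meromorphicOrderAt_eq_zero_iff.2 hne).ge

theorem analyticAt_log (hG : IsVignerasGamma G) (r : ℕ) {x : ℝ} (hx : 0 ≤ x) :
    AnalyticAt ℝ (fun t : ℝ => Real.log (G r (t + 1)).re) x := by
  have h1 : AnalyticAt ℝ (fun t : ℝ => G r (t + 1)) x :=
    ((hG.analyticAt r hx).restrictScalars (𝕜 := ℝ)).comp_of_eq
      (f := fun t : ℝ => (t : ℂ) + 1) ((Complex.ofRealCLM.analyticAt x).add analyticAt_const) rfl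
  exact AnalyticAt.log ((Complex.reCLM.analyticAt _).comp h1) (hG.pos r x hx).1

/-- Condition (iii) holds only off a discrete set; continuity of both sides makes it pointwise here.
-/
theorem apply_add_one (hG : IsVignerasGamma G) (r : ℕ) {x : ℝ} (hx : 0 ≤ x) :
    G (r + 1) (x + 1 + 1) = G r (x + 1) * G (r + 1) (x + 1) := by
  have h1 : (fun z => G (r + 1) (z + 1)) =ᶠ[nhdsWithin ((x : ℂ) + 1) {(x : ℂ) + 1}ᶜ]
      fun z => G r z * G (r + 1) z := by
    have := mem_codiscreteWithin_iff_forall_mem_nhdsNE.1 (hG.functional_eq r) (x + 1) (Set.mem_univ _)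
    rw [Set.compl_univ, Set.union_empty] at this
    exact this
  have h2 : ContinuousAt (fun z => G (r + 1) (z + 1)) (x + 1) := by
    have h3 := (hG.analyticAt (r + 1) (x := x + 1) (by linarith)).continuousAt
    push_cast at h3
    exact ContinuousAt.comp (f := fun z : ℂ => z + 1) h3 (by fun_prop)
  have h3 : ContinuousAt (fun z => G r z * G (r + 1) z) (x + 1) :=
    (hG.analyticAt r hx).continuousAt.mul (hG.analyticAt (r + 1) hx).continuousAt
  exact ((ContinuousAt.eventuallyEq_nhds_iff_eventuallyEq_nhdsNE h2 h3).1 h1).eq_of_nhds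

theorem log_add_one (hG : IsVignerasGamma G) (r : ℕ) {x : ℝ} (hx : 0 ≤ x) :
    Real.log (G (r + 1) ((x + 1 : ℝ) + 1)).re
      = Real.log (G (r + 1) (x + 1)).re + Real.log (G r (x + 1)).re := by
  push_cast
  rw [hG.apply_add_one r hx, Complex.mul_re, (hG.pos r x hx).2, zero_mul, sub_zero,
    Real.log_mul (hG.pos r x hx).1.ne' (hG.pos (r + 1) x hx).1.ne', add_comm]

theorem eq_vignerasG (hG : IsVignerasGamma G) (r : ℕ) : G r = vignerasG r := by
  have hV := isVignerasGamma_vignerasG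
  induction r with
  | zero => ext z; rw [hG.zero_eq, hV.zero_eq]
  | succ r ih =>
    obtain ⟨c, hc⟩ := exists_sub_eq_const_of_difference_equation (n := r + 1)
      (f := fun t : ℝ => Real.log (G (r + 1) (t + 1)).re)
      (g := fun t : ℝ => Real.log (vignerasG (r + 1) (t + 1)).re)
      (φ := fun t : ℝ => Real.log (vignerasG r (t + 1)).re)
      (fun t ht => hG.analyticAt_log (r + 1) (le_of_lt ht))
      (fun t ht => hV.analyticAt_log (r + 1) (le_of_lt ht))
      (fun t ht => hV.analyticAt_log r (le_of_lt ht))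
      (fun t ht => by rw [hG.log_add_one r ht.le, ih]) (fun t ht => hV.log_add_one r ht.le)
      (fun t ht => hG.deriv_log_nonneg (r + 1) t ht.le)
      (fun t ht => hV.deriv_log_nonneg (r + 1) t ht.le)
      (fun t ht => by
        have hpos : ∀ N : ℕ, -1 < t + N := fun N => by
          linarith [Nat.cast_nonneg (α := ℝ) N]
        -- The derivative of order `r + 1` of `log G_r` is `r!` times Barnes' series at `s = r + 1`,
        -- which decays.
        have h1 := tendsto_barnesSeries_atTop (r := r) (s := ((r + 1 : ℕ) : ℂ)) (x := t + 1)
          (by simp) (by linarith)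
        have h2 := (Complex.continuous_re.tendsto _).comp (h1.const_mul (r.factorial : ℂ))
        rw [mul_zero, Complex.zero_re] at h2
        refine h2.congr fun N => ?_
        rw [iteratedDeriv_log_vignerasG r _ (hpos N), iteratedDeriv_vignerasLog r (by
          simp; linarith [hpos N])]
        simp only [Function.comp_apply]
        congr 3
        push_cast; ring)
    -- The constant is only known for `t > 0`, so it is evaluated at `t = 1`, using `G_{r+1}(2) =
    -- G_r(1) G_{r+1}(1) = 1`.
    have h0 : c = 0 := by
      rw [← hc 1 one_pos]
      have e1 := hG.log_add_one r le_rfl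
      have e2 := hV.log_add_one r le_rfl
      simp only [zero_add, Complex.ofReal_zero, hG.map_one, hV.map_one] at e1 e2
      simp only [e1, e2]
      simp
    have hreal : ∀ x : ℝ, 1 < x → G (r + 1) x = vignerasG (r + 1) x := by
      intro x hx
      have h1 := hc (x - 1) (by linarith)
      have hx0 : 0 ≤ x - 1 := by linarith
      have h2 := Real.log_injOn_pos (Set.mem_Ioi.2 (hG.pos (r + 1) (x - 1) hx0).1)
        (Set.mem_Ioi.2 (hV.pos (r + 1) (x - 1) hx0).1) (by linarith)
      have h3 := hG.ofReal_eq (r + 1) hx0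
      rw [h2, ← hV.ofReal_eq (r + 1) hx0] at h3
      simpa using h3
    have hNF := fun z => hG.meromorphic (r + 1) (Set.mem_univ z)
    ext z
    -- Normal forms agreeing on a punctured neighbourhood also agree at the centre.
    exact (((hNF z).eventuallyEq_nhdsNE_iff_eventuallyEq_nhds (meromorphicNFAt_vignerasG (r + 1) z)).1
      (eventuallyEq_nhdsNE_of_frequently_eq (fun z => (hNF z).meromorphicAt)
        (fun z => (meromorphicNFAt_vignerasG (r + 1) z).meromorphicAt)
        (frequently_nhdsNE_ofReal hreal) z)).eq_of_nhds

end IsVignerasGamma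

/-! ### The multiplication formula -/

theorem prod_vignerasG_of_le {p : ℕ} (hp : 0 < p) (r : ℕ) {x : ℝ} (hx : (p : ℝ) ≤ x) :
    ∏ q : Fin r → Fin p, vignerasG r (((x : ℂ) + ∑ i, ((q i : ℕ) : ℂ)) / p)
      = Complex.exp (vignerasPhi p r x) * (p : ℂ) ^ (-vignerasPsi r x) * vignerasG r x := by
  have hp1 : (1 : ℝ) ≤ p := by exact_mod_cast hp
  have hpc : (p : ℂ) ≠ 0 := by exact_mod_cast hp.ne'
  have hq : ∀ q : Fin r → Fin p, 0 < (((x : ℂ) + ∑ i, ((q i : ℕ) : ℂ)) / p).re := fun q => by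
    have h1 : ((x : ℂ) + ∑ i, ((q i : ℕ) : ℂ)) / p = ((x + ∑ i, ((q i : ℕ) : ℝ)) / p : ℝ) := by
      push_cast; rfl
    rw [h1, Complex.ofReal_re]
    exact one_pos.trans_le (one_le_add_div hp hx (by positivity))
  have hx0 : 0 < (x : ℂ).re := by rw [Complex.ofReal_re]; linarith
  have h1 := multisum_vignerasLog hp r hx
  rw [multisum] at h1
  rw [Finset.prod_congr rfl fun q _ => vignerasG_eq_exp r (hq q), ← Complex.exp_sum, h1,
    vignerasG_eq_exp r hx0, Complex.cpow_def_of_ne_zero hpc, ← Complex.exp_add, ← Complex.exp_add]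
  ring_nf

theorem differentiable_vignerasPsi (r : ℕ) : Differentiable ℂ (vignerasPsi r) := by
  obtain ⟨Q, hQ⟩ := exists_vignerasPsi_eq_eval r
  rw [funext hQ]
  exact Q.differentiable

theorem differentiable_vignerasPhi (p r : ℕ) : Differentiable ℂ (vignerasPhi p r) := by
  obtain ⟨Q, -, hQ⟩ := exists_vignerasZetaPart_eq_eval r
  have hd : Differentiable ℂ (vignerasZetaPart r) := by
    rw [funext hQ]
    exact Q.differentiable
  rw [funext (vignerasPhi_eq p r)]
  refine Differentiable.sub (Differentiable.fun_sum fun q _ => ?_) hd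
  exact hd.comp ((differentiable_id.add_const _).div_const _)

/-- Take `q₁ = n mod p` and all other `q_i = 0`: some factor of the product then sits at a zero or
pole. -/
theorem exists_add_sum_div_eq_neg {p : ℕ} (hp : 0 < p) (r n : ℕ) :
    ∃ q : Fin (r + 1) → Fin p, ∃ m : ℕ, (-(n : ℂ) + ∑ i, ((q i : ℕ) : ℂ)) / p = -m := by
  have hpc : (p : ℂ) ≠ 0 := by exact_mod_cast hp.ne'
  refine ⟨Fin.cons ⟨n % p, Nat.mod_lt n hp⟩ fun _ => ⟨0, hp⟩, n / p, ?_⟩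
  rw [Fin.sum_univ_succ]
  simp only [Fin.cons_zero, Fin.cons_succ, Nat.cast_zero, Finset.sum_const_zero, add_zero]
  rw [div_eq_iff hpc]
  have : ((p * (n / p) + n % p : ℕ) : ℂ) = n := by rw [Nat.div_add_mod]
  push_cast at this
  linear_combination this

theorem prod_vignerasG {p : ℕ} (hp : 0 < p) (r : ℕ) (z : ℂ) :
    ∏ q : Fin r → Fin p, vignerasG r ((z + ∑ i, ((q i : ℕ) : ℂ)) / p)
      = Complex.exp (vignerasPhi p r z) * (p : ℂ) ^ (-vignerasPsi r z) * vignerasG r z := by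
  have hpc : (p : ℂ) ≠ 0 := by exact_mod_cast hp.ne'
  have hm : Meromorphic (vignerasG r) := fun z => (meromorphicNFAt_vignerasG r z).meromorphicAt
  have hfac : Differentiable ℂ fun z => Complex.exp (vignerasPhi p r z) * (p : ℂ) ^ (-vignerasPsi r z) :=
    (differentiable_vignerasPhi p r).cexp.mul
      ((differentiable_vignerasPsi r).neg.const_cpow (Or.inl hpc))
  have haff : ∀ (S z : ℂ), AnalyticAt ℂ (fun z => (z + S) / p) z := fun S z => by fun_prop
  have hev := eventuallyEq_nhdsNE_of_frequently_eq
    (f := fun z => ∏ q : Fin r → Fin p, vignerasG r ((z + ∑ i, ((q i : ℕ) : ℂ)) / p))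
    (g := fun z => Complex.exp (vignerasPhi p r z) * (p : ℂ) ^ (-vignerasPsi r z) * vignerasG r z)
    (fun z => MeromorphicAt.fun_prod fun q _ => (hm _).comp_analyticAt (haff _ z))
    (fun z => (hfac.analyticAt z).meromorphicAt.mul (hm z))
    (frequently_nhdsNE_ofReal (a := (p : ℝ)) fun x hx => prod_vignerasG_of_le hp r hx.le) z
  -- At `z = -n` the values are conventional when `r ≥ 1`, so continuity cannot be used. Elsewhere
  -- all arguments avoid these points.
  by_cases hz : ∃ n : ℕ, z = -n
  · obtain ⟨n, rfl⟩ := hz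
    cases r with
    | zero =>
      -- Here `φ₀ = 0` and `ψ₀ = 1`, so the claim is `z / p = p⁻¹ z`.
      simp [vignerasG, vignerasPhi, vignerasPsi, Complex.cpow_neg]
      field_simp
    | succ r =>
      obtain ⟨q, m, hqm⟩ := exists_add_sum_div_eq_neg hp r n
      rw [vignerasG_succ_neg_natCast, mul_zero]
      refine Finset.prod_eq_zero (Finset.mem_univ q) ?_
      rw [hqm, vignerasG_succ_neg_natCast]
  · push Not at hz
    have hq : ∀ q : Fin r → Fin p, ∀ n : ℕ, (z + ∑ i, ((q i : ℕ) : ℂ)) / p ≠ -n := by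
      intro q n h
      rw [div_eq_iff hpc] at h
      refine hz (n * p + ∑ i, (q i : ℕ)) ?_
      push_cast
      linear_combination h
    refine ((ContinuousAt.eventuallyEq_nhds_iff_eventuallyEq_nhdsNE ?_ ?_).1 hev).eq_of_nhds
    · exact (Finset.analyticAt_fun_prod _ fun q _ =>
        (vignerasG_analyticAt_and_ne_zero r (hq q)).1.fun_comp
          (f := fun z => (z + ∑ i, ((q i : ℕ) : ℂ)) / p) (haff _ z)).continuousAt
    · exact hfac.continuous.continuousAt.mul (vignerasG_analyticAt_and_ne_zero r hz).1.continuousAt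

end

theorem theorem2 :
    (∃! G : ℕ → ℂ → ℂ, IsVignerasGamma G) ∧
    ∀ G : ℕ → ℂ → ℂ, IsVignerasGamma G →
      ∀ r p : ℕ, 0 < p → ∀ z : ℂ,
        ∏ q : Fin r → Fin p, G r ((z + ∑ i, ((q i : ℕ) : ℂ)) / p)
          = Complex.exp (vignerasPhi p r z) * (p : ℂ) ^ (-vignerasPsi r z) * G r z := by
  refine ⟨⟨vignerasG, isVignerasGamma_vignerasG, fun G hG => funext hG.eq_vignerasG⟩, ?_⟩
  intro G hG r p hp z
  rw [hG.eq_vignerasG r]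
  exact prod_vignerasG hp r z
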